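/- Let $M$ be a smooth finite-dimensional (Hausdorff, boundaryless) Riemannian manifold with Levi-Civita connection $\nabla$, let $f:M\to\mathbb{R}$ be smooth, with Riemannian gradient $\operatorname{grad} f$ and Hessian $\operatorname{Hess} f(x)[\eta]=\nabla_\eta\operatorname{grad} f$, and put $h(x)=\|\operatorname{grad} f(x)\|^2$. Let $R:TM\to M$ be a retraction, i.e. a smooth map such that $R_x:=R|_{T_xM}$ satisfies $R_x(0)=x$ and $DR_x(0)=\mathrm{id}_{T_xM}$ for every $x$. Fix $\alpha>0$ and $\beta,\sigma\in(0,1)$. One iteration of the geometric Newton method with Armijo line search takes $x$ to $R_x(t\eta)$, where $\eta\in T_xM$ solves the Newton equation $\operatorname{Hess} f(x)[\eta]=-\operatorname{grad} f(x)$, and $t=\alpha\beta^l$ with $l\in\{0,1,2,\dots\}$ the smallest number for which Armijo's condition $$h(R_x(t\eta))\le h(x)+\sigma\,t\,Dh(x)[\eta]$$ holds. A sequence $(x_k)_{k\ge0}$ in which each $x_{k+1}$ is obtained from $x_k$ by one iteration is called a run. Let $x^*$ be a stationary point of $f$ and let $\mathcal I$ be a neighbourhood of $x^*$ such that $\operatorname{grad}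 f(x)\neq0$ for all $x\in\mathcal I\setminus\{x^*\}$ and $\operatorname{Hess} f(x)$ is injective for all $x\in\mathcal I$. Then: 1. For every $x\in\mathcal I$ the Newton equation has a unique solution $\eta$, and Armijo's condition holds for some $t=\alpha\beta^l$, $l\in\{0,1,2,\dots\}$; so the iteration is well defined on $\mathcal I$. 2. There is a neighbourhood $U\subseteq\mathcal I$ of $x^*$ such that for every $x_0\in U$ there is exactly one run starting at $x_0$; it stays in $\mathcal I$ and converges to $x^*$. 3. Every run (starting anywhere in $\mathcal I$) that stays in a compact subset of $\mathcal I$ converges to $x^*$. 4. In 2 and 3 the convergence is quadratic, provided that the line search admits the full Newton step in the following sense: $\sigma<1/2$, and there is $m\ge0$ with $\alpha\beta^m=1$ and $\alpha\beta^j>2(1-\sigma)$ for all $0\le j<m$ (for instance $\alpha=1$, $\sigma<1/2$). Here $x_k\to x^*$ quadratically if in a chart $\varphi$ around $x^*$ (equivalently, in every such chart) there is a constant $c$ with $\|\varphi(x_{k+1})-\varphi(x^*)\|\le c\,\|\varphi(x_k)-\varphi(x^*)\|^2$ for all sufficiently large $k$. -/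

import Mathlib

open Filter Topology Bundle Manifold
open scoped ContDiff

noncomputable section
namespace RiemNewton

set_option linter.unusedSectionVars false

variable {E : Type*} [NormedAddCommGroup E] [NormedSpace ℝ E] [FiniteDimensional ℝ E]
  {M : Type*} [TopologicalSpace M] [ChartedSpace E M] [IsManifold 𝓘(ℝ, E) ∞ M]
  [RiemannianBundle (fun x : M => TangentSpace 𝓘(ℝ, E) x)]

instance instFiniteDimensionalTangent (x : M) : FiniteDimensional ℝ (TangentSpace 𝓘(ℝ, E) x) :=
  inferInstanceAs (FiniteDimensional ℝ E)

instance instCompleteTangent (x : M) : CompleteSpace (TangentSpace 𝓘(ℝ, E) x) := FiniteDimensional.complete ℝ _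

/-- The Riemannian gradient: the Riesz representative of the differential of `f` at `x`. -/
def grad (f : M → ℝ) (x : M) : TangentSpace 𝓘(ℝ, E) x :=
  (InnerProductSpace.toDual ℝ (TangentSpace 𝓘(ℝ, E) x)).symm (d% f x)

theorem inner_grad (f : M → ℝ) (x : M) (v : TangentSpace 𝓘(ℝ, E) x) :
    inner ℝ (grad f x) v = d% f x v := by
  simp [grad]

/-- The right-hand side of the Koszul formula for `2 ⟨∇_X Y, Z⟩` at `x`. -/
def koszul (X Y Z : Π x : M, TangentSpace 𝓘(ℝ, E) x) (x : M) : ℝ :=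
  d% (fun y => inner ℝ (Y y) (Z y)) x (X x)
  + d% (fun y => inner ℝ (Z y) (X y)) x (Y x)
  - d% (fun y => inner ℝ (X y) (Y y)) x (Z x)
  + inner ℝ (VectorField.mlieBracket 𝓘(ℝ, E) X Y x) (Z x)
  - inner ℝ (VectorField.mlieBracket 𝓘(ℝ, E) Y Z x) (X x)
  + inner ℝ (VectorField.mlieBracket 𝓘(ℝ, E) Z X x) (Y x)

variable [IsContMDiffRiemannianBundle 𝓘(ℝ, E) ∞ E (fun x : M => TangentSpace 𝓘(ℝ, E) x)]

theorem mdiff_inner {X Y : Π x : M, TangentSpace 𝓘(ℝ, E) x} {x : M}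
    (hX : MDiffAt (T% X) x) (hY : MDiffAt (T% Y) x) :
    MDiffAt (fun y => inner ℝ (X y) (Y y)) x :=
  MDifferentiableAt.inner_bundle (F := E) (E := fun x : M => TangentSpace 𝓘(ℝ, E) x)
    (IB := 𝓘(ℝ, E)) (b := fun y => y) hX hY

theorem koszul_tensorial_right (X Y : Π x : M, TangentSpace 𝓘(ℝ, E) x) {x : M}
    (hX : MDiffAt (T% X) x) (hY : MDiffAt (T% Y) x) :
    TensorialAt 𝓘(ℝ, E) E (fun Z => koszul X Y Z x) x where
  smul {g Z} hg hZ := by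
    have h1 := mdiff_inner hY hZ
    have h2 := mdiff_inner hZ hX
    simp [koszul, VectorField.mlieBracket_smul_left hg hZ, VectorField.mlieBracket_smul_right hg hZ,
      inner_add_left, inner_smul_left, inner_smul_right, mvfderiv_fun_mul hg h1, mvfderiv_fun_mul hg h2]
    rw [real_inner_comm (Y x) (Z x)]
    ring
  add {Z Z'} hZ hZ' := by
    simp [koszul, VectorField.mlieBracket_add_left hZ hZ', VectorField.mlieBracket_add_right hZ hZ',
      inner_add_left, inner_add_right, mvfderiv_fun_add (mdiff_inner hY hZ) (mdiff_inner hY hZ'),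
      mvfderiv_fun_add (mdiff_inner hZ hX) (mdiff_inner hZ' hX)]
    ring

theorem koszul_tensorial_left (Y Z : Π x : M, TangentSpace 𝓘(ℝ, E) x) {x : M}
    (hY : MDiffAt (T% Y) x) (hZ : MDiffAt (T% Z) x) :
    TensorialAt 𝓘(ℝ, E) E (fun X => koszul X Y Z x) x where
  smul {g X} hg hX := by
    have h1 := mdiff_inner hX hY
    have h2 := mdiff_inner hZ hX
    simp [koszul, VectorField.mlieBracket_smul_left hg hX, VectorField.mlieBracket_smul_right hg hX,
      inner_add_left, inner_smul_left, inner_smul_right, mvfderiv_fun_mul hg h1, mvfderiv_fun_mul hg h2]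
    rw [real_inner_comm (Z x) (X x)]
    ring
  add {X X'} hX hX' := by
    simp [koszul, VectorField.mlieBracket_add_left hX hX', VectorField.mlieBracket_add_right hX hX',
      inner_add_left, inner_add_right, mvfderiv_fun_add (mdiff_inner hX hY) (mdiff_inner hX' hY),
      mvfderiv_fun_add (mdiff_inner hZ hX) (mdiff_inner hZ hX')]
    ring


/-- `koszul X Y Z x` as a bilinear form in the values `X x` and `Z x`. -/
def koszulForm (Y : Π x : M, TangentSpace 𝓘(ℝ, E) x) (x : M) (hY : MDiffAt (T% Y) x) :
    TangentSpace 𝓘(ℝ, E) x →L[ℝ] TangentSpace 𝓘(ℝ, E) x →L[ℝ] ℝ :=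
  TensorialAt.mkHom₂ (I := 𝓘(ℝ, E)) (F := E) (F' := E) (V := fun x : M => TangentSpace 𝓘(ℝ, E) x)
    (V' := fun x : M => TangentSpace 𝓘(ℝ, E) x) (fun X Z => koszul X Y Z x) x
    (fun _ hZ => koszul_tensorial_left Y _ hY hZ)
    (fun _ hX => koszul_tensorial_right _ Y hX hY)

open Classical in
/-- The linear map `v ↦ ∇_v Y` at `x`, given by the Koszul formula
(and `0` if `Y` is not differentiable at `x`). -/
def leviCivitaFun (Y : Π x : M, TangentSpace 𝓘(ℝ, E) x) (x : M) :
    TangentSpace 𝓘(ℝ, E) x →L[ℝ] TangentSpace 𝓘(ℝ, E) x :=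
  if hY : MDiffAt (T% Y) x then
    LinearMap.toContinuousLinearMap
      { toFun := fun v => (InnerProductSpace.toDual ℝ (TangentSpace 𝓘(ℝ, E) x)).symm
          ((1 / 2 : ℝ) • koszulForm Y x hY v)
        map_add' := fun v w => by rw [map_add, smul_add, map_add]
        map_smul' := fun c v => by
          rw [(koszulForm Y x hY).map_smul, smul_comm (1 / 2 : ℝ) c]; exact map_smulₛₗ _ c _ }
  else 0

theorem inner_leviCivitaFun {X Y Z : Π x : M, TangentSpace 𝓘(ℝ, E) x} {x : M}
    (hX : MDiffAt (T% X) x) (hY : MDiffAt (T% Y) x) (hZ : MDiffAt (T% Z) x) :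
    inner ℝ (leviCivitaFun Y x (X x)) (Z x) = koszul X Y Z x / 2 := by
  have h : koszulForm Y x hY (X x) (Z x) = koszul X Y Z x :=
    TensorialAt.mkHom₂_apply (I := 𝓘(ℝ, E)) (F := E) (F' := E)
      (V := fun x : M => TangentSpace 𝓘(ℝ, E) x)
      (V' := fun x : M => TangentSpace 𝓘(ℝ, E) x) (Φ := fun X Z => koszul X Y Z x)
      (fun _ hZ => koszul_tensorial_left Y _ hY hZ)
      (fun _ hX => koszul_tensorial_right _ Y hX hY) hX hZ
  have h1 : leviCivitaFun Y x (X x) = (InnerProductSpace.toDual ℝ (TangentSpace 𝓘(ℝ, E) x)).symm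
      ((1 / 2 : ℝ) • koszulForm Y x hY (X x)) := by
    simp only [leviCivitaFun, hY, dif_pos]
    rfl
  have h2 : inner ℝ ((InnerProductSpace.toDual ℝ (TangentSpace 𝓘(ℝ, E) x)).symm
      ((1 / 2 : ℝ) • koszulForm Y x hY (X x))) (Z x) =
        (1 / 2 : ℝ) * koszulForm Y x hY (X x) (Z x) :=
    InnerProductSpace.toDual_symm_apply
  rw [h1, h2, h]
  ring

theorem inner_leviCivitaFun_extend {Y : Π x : M, TangentSpace 𝓘(ℝ, E) x} {x : M}
    (hY : MDiffAt (T% Y) x) (v w : TangentSpace 𝓘(ℝ, E) x) :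
    inner ℝ (leviCivitaFun Y x v) w =
      koszul (FiberBundle.extend E v) Y (FiberBundle.extend E w) x / 2 := by
  have h := inner_leviCivitaFun (FiberBundle.mdifferentiableAt_extend 𝓘(ℝ, E) E v) hY
    (FiberBundle.mdifferentiableAt_extend 𝓘(ℝ, E) E w)
  simpa using h

/-- The Riemannian (Levi-Civita) connection of `M`; `leviCivita Y x v` is `(∇_v Y)_x`. -/
def leviCivita : CovariantDerivative 𝓘(ℝ, E) E (fun x : M => TangentSpace 𝓘(ℝ, E) x) where
  toFun := leviCivitaFun
  isCovariantDerivativeOnUniv :=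
    { add := by
        intro Y Y' x hY hY' _
        ext v
        refine ext_inner_right ℝ fun w => ?_
        have hX := FiberBundle.mdifferentiableAt_extend 𝓘(ℝ, E) E v
        have hZ := FiberBundle.mdifferentiableAt_extend 𝓘(ℝ, E) E w
        have hs : MDiffAt (T% (Y + Y')) x := mdifferentiableAt_add_section hY hY'
        rw [add_apply, inner_add_left]
        rw [inner_leviCivitaFun_extend hs, inner_leviCivitaFun_extend hY,
          inner_leviCivitaFun_extend hY']
        simp [koszul, VectorField.mlieBracket_add_left hY hY',
          VectorField.mlieBracket_add_right hY hY', inner_add_left, inner_add_right,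
          mvfderiv_fun_add (mdiff_inner hX hY) (mdiff_inner hX hY'),
          mvfderiv_fun_add (mdiff_inner hY hZ) (mdiff_inner hY' hZ)]
        ring
      leibniz := by
        intro Y g x hY hg _
        ext v
        refine ext_inner_right ℝ fun w => ?_
        have hX := FiberBundle.mdifferentiableAt_extend 𝓘(ℝ, E) E v
        have hZ := FiberBundle.mdifferentiableAt_extend 𝓘(ℝ, E) E w
        have hs : MDiffAt (T% (g • Y)) x := hg.smul_section hY
        rw [add_apply, inner_add_left, smul_apply,
          inner_smul_left, ContinuousLinearMap.smulRight_apply, inner_smul_left]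
        rw [inner_leviCivitaFun_extend hs, inner_leviCivitaFun_extend hY]
        simp [koszul, VectorField.mlieBracket_smul_left hg hY,
          VectorField.mlieBracket_smul_right hg hY, inner_add_left, inner_smul_left,
          inner_smul_right, mvfderiv_fun_mul hg (mdiff_inner hX hY),
          mvfderiv_fun_mul hg (mdiff_inner hY hZ)]
        rw [real_inner_comm v (Y x)]
        ring }

/-- The connection is compatible with the metric. -/
theorem leviCivita_metric {X Y Z : Π x : M, TangentSpace 𝓘(ℝ, E) x} {x : M}
    (hX : MDiffAt (T% X) x) (hY : MDiffAt (T% Y) x) (hZ : MDiffAt (T% Z) x) :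
    d% (fun y => inner ℝ (Y y) (Z y)) x (X x) =
      inner ℝ (leviCivita Y x (X x)) (Z x) + inner ℝ (Y x) (leviCivita Z x (X x)) := by
  have h1 : inner ℝ (leviCivita Y x (X x)) (Z x) = _ := inner_leviCivitaFun hX hY hZ
  have h2 : inner ℝ (leviCivita Z x (X x)) (Y x) = _ := inner_leviCivitaFun hX hZ hY
  rw [real_inner_comm (leviCivita Z x (X x)) (Y x), h1, h2]
  have e (A B : Π x : M, TangentSpace 𝓘(ℝ, E) x) :
      (fun y => inner ℝ (A y) (B y)) = fun y => inner ℝ (B y) (A y) :=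
    funext fun y => real_inner_comm _ _
  simp only [koszul]
  rw [e Z Y, e Y X, e Z X, VectorField.mlieBracket_swap (V := Z) (W := Y),
    VectorField.mlieBracket_swap (V := Y) (W := X), VectorField.mlieBracket_swap (V := Z) (W := X)]
  simp only [Pi.neg_apply, inner_neg_left]
  ring

/-- The connection is torsion-free. -/
theorem leviCivita_torsion : (leviCivita (E := E) (M := M)).torsion = 0 := by
  rw [CovariantDerivative.torsion_eq_zero_iff]
  intro X Y x hX hY
  refine ext_inner_right ℝ fun w => ?_
  have hZ := FiberBundle.mdifferentiableAt_extend 𝓘(ℝ, E) E w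
  have h1 := inner_leviCivitaFun hX hY hZ
  have h2 := inner_leviCivitaFun hY hX hZ
  simp only [FiberBundle.extend_apply_self] at h1 h2
  have h3 : inner ℝ (leviCivita Y x (X x) - leviCivita X x (Y x)) w =
      inner ℝ (leviCivitaFun Y x (X x)) w - inner ℝ (leviCivitaFun X x (Y x)) w :=
    inner_sub_left _ _ _
  rw [h3, h1, h2]
  have e (A B : Π x : M, TangentSpace 𝓘(ℝ, E) x) :
      (fun y => inner ℝ (A y) (B y)) = fun y => inner ℝ (B y) (A y) :=
    funext fun y => real_inner_comm _ _
  simp only [koszul]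
  set Z : Π x : M, TangentSpace 𝓘(ℝ, E) x := FiberBundle.extend E w
  have hw : Z x = w := FiberBundle.extend_apply_self E w
  rw [e Z Y, e Y X, e Z X, VectorField.mlieBracket_swap (V := Z) (W := Y),
    VectorField.mlieBracket_swap (V := Y) (W := X), VectorField.mlieBracket_swap (V := Z) (W := X)]
  simp only [Pi.neg_apply, inner_neg_left, hw]
  ring

/-- The Riemannian Hessian `η ↦ ∇_η grad f` at `x`. -/
def hess (f : M → ℝ) (x : M) : TangentSpace 𝓘(ℝ, E) x →L[ℝ] TangentSpace 𝓘(ℝ, E) x :=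
  leviCivita (fun y => grad f y) x

/-- The merit function `h = ‖grad f‖²`. -/
def merit (f : M → ℝ) (x : M) : ℝ := ‖grad (E := E) f x‖ ^ 2

variable (E M) in
/-- A retraction on `M`: a smooth map `R : TM → M` such that, for the restriction `R_x` of `R` to
`T_x M`, `R_x 0 = x` and the differential of `R_x` at `0` is the identity of `T_x M`
(the tangent space `T_x M` is, as a vector space, the model space `E`). -/
structure Retraction where
  toFun : TangentBundle 𝓘(ℝ, E) M → M
  smooth : ContMDiff 𝓘(ℝ, E).tangent 𝓘(ℝ, E) ∞ toFun
  map_zero : ∀ x : M, toFun ⟨x, 0⟩ = x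
  rigid : ∀ x : M, HasMFDerivAt 𝓘(ℝ, E) 𝓘(ℝ, E)
    (fun v : E => toFun (⟨x, v⟩ : TangentBundle 𝓘(ℝ, E) M)) (0 : E) (ContinuousLinearMap.id ℝ E)

/-- `η` solves the Newton equation `Hess f(x)[η] = - grad f(x)`. -/
def IsNewtonDirection (f : M → ℝ) (x : M) (η : TangentSpace 𝓘(ℝ, E) x) : Prop :=
  hess f x η = - grad f x

/-- Armijo's condition for `h = ‖grad f‖²` at `x`, in the direction `η`, for the step size `t`:
`h (R_x (t η)) ≤ h x + σ t Dh(x)[η]`. -/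
def ArmijoCondition (R : Retraction E M) (f : M → ℝ) (σ : ℝ) (x : M)
    (η : TangentSpace 𝓘(ℝ, E) x) (t : ℝ) : Prop :=
  merit (E := E) f (R.toFun ⟨x, t • η⟩) ≤
    merit (E := E) f x + σ * t * d% (merit (E := E) f) x η

/-- `y` is obtained from `x` by one iteration: the Newton direction `η` at `x` is followed with
the step size `α β ^ l`, where `l` is the smallest natural number such that Armijo's condition
holds. -/
def IsNewtonArmijoStep (R : Retraction E M) (f : M → ℝ) (α β σ : ℝ) (x y : M) : Prop :=
  ∃ η : TangentSpace 𝓘(ℝ, E) x, IsNewtonDirection f x η ∧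
    ∃ l : ℕ, IsLeast {j : ℕ | ArmijoCondition R f σ x η (α * β ^ j)} l ∧
      y = R.toFun ⟨x, (α * β ^ l) • η⟩

/-- `x 0, x 1, …` is a sequence of iterates of the algorithm. -/
def IsNewtonArmijoRun (R : Retraction E M) (f : M → ℝ) (α β σ : ℝ) (x : ℕ → M) : Prop :=
  ∀ k, IsNewtonArmijoStep R f α β σ (x k) (x (k + 1))

variable (E) in
/-- The sequence `x` converges to `a` with (at least) quadratic rate, the error being measured in
the chart at `a`; the notion does not depend on the chart around `a`. -/
def ConvergesQuadratically (x : ℕ → M) (a : M) : Prop :=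
  Tendsto x atTop (𝓝 a) ∧ ∃ c : ℝ, ∀ᶠ k in atTop,
    ‖extChartAt 𝓘(ℝ, E) a (x (k + 1)) - extChartAt 𝓘(ℝ, E) a a‖ ≤
      c * ‖extChartAt 𝓘(ℝ, E) a (x k) - extChartAt 𝓘(ℝ, E) a a‖ ^ 2

/-- The line search is compatible with full Newton steps: `σ < 1 / 2`, the unit step is one of the
trial steps `α β ^ j`, and all trial steps before it exceed `2 (1 - σ)`. This holds if `α = 1` and
`σ < 1 / 2`. -/
def AdmitsUnitStep (α β σ : ℝ) : Prop :=
  σ < 1 / 2 ∧ ∃ m : ℕ, α * β ^ m = 1 ∧ ∀ j < m, 2 * (1 - σ) < α * β ^ j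

end RiemNewton

end

/-! Metric compatibility gives `Dh(x)[η] = 2⟨Hess f(x)[η], grad f(x)⟩`, which is `-2 h(x)` for a
Newton direction `η` (`IsNewtonDirection.mvfderiv_merit`). Armijo's condition therefore reads
`h(R_x(tη)) ≤ (1 - 2σt) h(x)`, a demand for linear decrease of `h`.

Where the Hessian is injective, `‖η‖` is locally bounded by a multiple of `‖grad f‖`, so the
second-order error of `h` along the step is `O(t²) h(x)`. Short steps are thus accepted with a
threshold that is locally uniform, even at the stationary point (`exists_armijo_nhds`). On a compact
set backtracking then keeps the steps bounded below and `h` contracts geometrically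
(`exists_merit_contraction`). As `h` has only the zero `x*` there, the run converges. Sublevel sets
of `h` near `x*` supply the invariant neighbourhoods (`exists_invariant_nhds`).

For the rate, in a chart a step of length `t` multiplies the error by `1 - t` up to a quadratic
term, and hence `h` by nearly `(1 - t)²` (`exists_step_sub_le`, `eventually_merit_step`). Comparing
`(1 - t)²` with `1 - 2σt` shows that near `x*` the trial `t = 1` passes and trials with `t > 2(1 -
σ)` fail. The full Newton step is then taken, and it contracts quadratically.

Coordinates enter through the lowered Newton equation `B u η = -F u`, where `F` is the coordinate
differential of `f` and `B` is the Hessian as a bilinear form. The two satisfy `B = DF` at a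
stationary point (`coordForm_hess_eq_fderiv`), which is all the rate needs. -/

noncomputable section
namespace RiemNewton

/-! ### Taylor estimates and stability of injectivity in normed spaces -/

section Analysis

variable {X Y : Type*} [NormedAddCommGroup X] [NormedSpace ℝ X]
  [NormedAddCommGroup Y] [NormedSpace ℝ Y]

/-- First-order Taylor expansion with a quadratic remainder that is uniform in the base point. -/
theorem exists_taylor_one_le {g : X → Y} {z : X} (hg : ContDiffAt ℝ 2 g z) :
    ∃ C : ℝ, 0 ≤ C ∧ ∀ᶠ p : X × X in 𝓝 (z, z),
      ‖g p.2 - g p.1 - fderiv ℝ g p.1 (p.2 - p.1)‖ ≤ C * ‖p.2 - p.1‖ ^ 2 := by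
  have h1 : ContDiffAt ℝ 1 (fderiv ℝ g) z := hg.fderiv_right (by norm_num)
  obtain ⟨K, s, hs, hK⟩ := h1.exists_lipschitzOnWith
  have hd : ∀ᶠ y in 𝓝 z, DifferentiableAt ℝ g y := by
    filter_upwards [hg.eventually (by simp)] with y hy using hy.differentiableAt (by simp)
  obtain ⟨ε, hε, hball⟩ := Metric.mem_nhds_iff.1 (inter_mem hs hd)
  refine ⟨K, K.2, ?_⟩
  rw [nhds_prod_eq]
  filter_upwards [prod_mem_prod (Metric.ball_mem_nhds z hε) (Metric.ball_mem_nhds z hε)]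
    with p hp
  obtain ⟨hp1, hp2⟩ := hp
  have hsub : segment ℝ p.1 p.2 ⊆ Metric.ball z ε := (convex_ball z ε).segment_subset hp1 hp2
  -- Mean value inequality for `g` minus its linearization at `p.1`: by the Lipschitz bound on
  -- `fderiv ℝ g`, the derivative of the difference is at most `K * ‖p.2 - p.1‖` on the segment.
  have h := (convex_segment p.1 p.2).norm_image_sub_le_of_norm_fderiv_le' (𝕜 := ℝ) (f := g)
    (φ := fderiv ℝ g p.1) (C := K * ‖p.2 - p.1‖) (fun y hy => (hball (hsub hy)).2) ?_
    (left_mem_segment ℝ _ _) (right_mem_segment ℝ _ _)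
  · calc _ ≤ _ := h
      _ = _ := by ring
  · intro y hy
    have h2 := hK.dist_le_mul y (hball (hsub hy)).1 p.1 (hball hp1).1
    rw [dist_eq_norm, dist_eq_norm] at h2
    refine h2.trans (mul_le_mul_of_nonneg_left ?_ K.2)
    rw [segment_eq_image'] at hy
    obtain ⟨θ, ⟨h0, h1'⟩, rfl⟩ := hy
    rw [add_sub_cancel_left, norm_smul, Real.norm_of_nonneg h0]
    exact mul_le_of_le_one_left (norm_nonneg _) h1'

theorem exists_taylor_one_at_le {g : X → Y} {z : X} (hg : ContDiffAt ℝ 2 g z) :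
    ∃ C : ℝ, 0 ≤ C ∧ ∀ᶠ y in 𝓝 z, ‖g y - g z - fderiv ℝ g z (y - z)‖ ≤ C * ‖y - z‖ ^ 2 := by
  obtain ⟨C, hC, h⟩ := exists_taylor_one_le hg
  have ht : Tendsto (fun y => (z, y)) (𝓝 z) (𝓝 (z, z)) :=
    (Continuous.prodMk_right z).tendsto z
  exact ⟨C, hC, ht.eventually h⟩

/-- Second-order Taylor expansion at a critical zero. -/
theorem exists_taylor_two_le {g : X → ℝ} {z : X} (hg : ContDiffAt ℝ 3 g z) (h0 : g z = 0)
    (h1 : fderiv ℝ g z = 0) :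
    ∃ C : ℝ, 0 ≤ C ∧ ∀ᶠ y in 𝓝 z,
      |g y - 1 / 2 * fderiv ℝ (fderiv ℝ g) z (y - z) (y - z)| ≤ C * ‖y - z‖ ^ 3 := by
  obtain ⟨C, hC, h⟩ := exists_taylor_one_at_le (g := fderiv ℝ g) (z := z)
    (hg.fderiv_right (by norm_num))
  have hd : ∀ᶠ y in 𝓝 z, DifferentiableAt ℝ g y := by
    filter_upwards [hg.eventually (by simp)] with y hy using hy.differentiableAt (by simp)
  obtain ⟨ε, hε, hball⟩ := Metric.mem_nhds_iff.1 (inter_mem h hd)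
  refine ⟨C, hC, ?_⟩
  filter_upwards [Metric.ball_mem_nhds z hε] with y hy
  set d := y - z with hdd
  set D := fderiv ℝ (fderiv ℝ g) z
  have hseg : ∀ s ∈ Set.Icc (0 : ℝ) 1, z + s • d ∈ Metric.ball z ε := by
    intro s hs
    rw [mem_ball_iff_norm, add_sub_cancel_left, norm_smul, Real.norm_of_nonneg hs.1]
    exact (mul_le_of_le_one_left (norm_nonneg _) hs.2).trans_lt (mem_ball_iff_norm.1 hy)
  -- Subtracting the quadratic model along the segment leaves a function of `s` whose derivative is
  -- the first-order Taylor remainder of `fderiv ℝ g`, applied to `d`; this is cubic in `‖d‖`.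
  have key := norm_image_sub_le_of_norm_deriv_le_segment_01'
    (f := fun s : ℝ => g (z + s • d) - s ^ 2 / 2 * D d d)
    (f' := fun s : ℝ => fderiv ℝ g (z + s • d) d - s * D d d) (C := C * ‖d‖ ^ 3) ?_ ?_
  · have e : z + d = y := by rw [hdd]; abel
    simpa [e, h0] using key
  · intro s hs
    have hl : HasDerivAt (fun s : ℝ => z + s • d) d s := by
      simpa using ((hasDerivAt_id s).smul_const d).const_add z
    have hgd := ((hball (hseg s hs)).2.hasFDerivAt).comp_hasDerivAt s hl
    have hq : HasDerivAt (fun s : ℝ => s ^ 2 / 2 * D d d) (s * D d d) s := by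
      have := (((hasDerivAt_id' s).fun_pow 2).div_const 2).mul_const (D d d)
      exact this.congr_deriv (by push_cast; ring)
    exact (hgd.sub hq).hasDerivWithinAt
  · intro s hs
    have hs' : s ∈ Set.Icc (0 : ℝ) 1 := ⟨hs.1, hs.2.le⟩
    have h2 := (hball (hseg s hs')).1
    simp only [Set.mem_ofPred_eq, h1, sub_zero, add_sub_cancel_left, map_smul] at h2
    have e : fderiv ℝ g (z + s • d) d - s * D d d = (fderiv ℝ g (z + s • d) - s • D d) d := by
      simp
    rw [e]
    calc _ ≤ ‖fderiv ℝ g (z + s • d) - s • D d‖ * ‖d‖ := ContinuousLinearMap.le_opNorm _ _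
      _ ≤ (C * ‖s • d‖ ^ 2) * ‖d‖ := by gcongr
      _ ≤ (C * ‖d‖ ^ 2) * ‖d‖ := by
        gcongr
        rw [norm_smul, Real.norm_of_nonneg hs.1]
        exact mul_le_of_le_one_left (norm_nonneg _) hs'.2
      _ = _ := by ring

/-- Injectivity of a linear map on a finite-dimensional space is quantitatively stable. -/
theorem exists_norm_le_mul_norm [FiniteDimensional ℝ X] {Z : Type*} [TopologicalSpace Z]
    {B : Z → X →L[ℝ] Y} {z : Z}
    (hB : ContinuousAt B z) (hinj : Function.Injective (B z)) :
    ∃ K : ℝ, 0 < K ∧ ∀ᶠ u in 𝓝 z, ∀ v, ‖v‖ ≤ K * ‖B u v‖ := by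
  obtain ⟨K, hK, hanti⟩ := LinearMap.exists_antilipschitzWith (B z : X →ₗ[ℝ] Y)
    (LinearMap.ker_eq_bot.2 hinj)
  have hK' : (0 : ℝ) < K := hK
  refine ⟨2 * K, by positivity, ?_⟩
  have hnear : ∀ᶠ u in 𝓝 z, ‖B u - B z‖ < 1 / (2 * K) := by
    have := hB.eventually (Metric.ball_mem_nhds (B z) (show (0 : ℝ) < 1 / (2 * K) by positivity))
    simpa only [Metric.mem_ball, dist_eq_norm] using this
  filter_upwards [hnear] with u hu v
  have h1 : ‖v‖ ≤ K * ‖B z v‖ := by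
    simpa using hanti.le_mul_dist v 0
  have h2 : ‖B z v‖ ≤ ‖B u v‖ + 1 / (2 * K) * ‖v‖ := by
    calc ‖B z v‖ = ‖B u v - (B u - B z) v‖ := by simp
      _ ≤ ‖B u v‖ + ‖(B u - B z) v‖ := norm_sub_le _ _
      _ ≤ _ := by gcongr; exact (ContinuousLinearMap.le_opNorm _ _).trans (by gcongr)
  have h3 : ‖v‖ ≤ K * ‖B u v‖ + ‖v‖ / 2 := by
    calc ‖v‖ ≤ K * (‖B u v‖ + 1 / (2 * K) * ‖v‖) := h1.trans (by gcongr)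
      _ = _ := by field_simp
  linarith

end Analysis

/-! ### The Newton step in a vector space, for the equation `B u η = -F u` -/

section LocalModel

variable {E : Type*} [NormedAddCommGroup E] [NormedSpace ℝ E] [FiniteDimensional ℝ E]
  {G : Type*} [NormedAddCommGroup G] [NormedSpace ℝ G]
  {F : E → G} {B : E → E →L[ℝ] G} {a : E}

/-- Short steps in the Newton direction satisfy Armijo's condition, uniformly near a point. -/
theorem exists_uniform_armijo {ψ : E × E → ℝ} {c σ : ℝ}
    (hψ : ContDiffAt ℝ 2 ψ (a, 0)) (hF : ContinuousAt F a) (hB : ContinuousAt B a)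
    (hinj : Function.Injective (B a)) (hc : 0 < c)
    (hlow : ∀ᶠ u in 𝓝 a, c * ‖F u‖ ^ 2 ≤ ψ (u, 0))
    (hd : ∀ᶠ u in 𝓝 a, ∀ η, B u η = -F u → fderiv ℝ ψ (u, 0) (0, η) = -2 * ψ (u, 0))
    (hσ : σ < 1) :
    ∃ t₀ : ℝ, 0 < t₀ ∧ ∀ᶠ u in 𝓝 a, ∀ η, B u η = -F u → ∀ t, 0 < t → t ≤ t₀ →
      ψ (u, t • η) ≤ (1 - 2 * σ * t) * ψ (u, 0) := by
  obtain ⟨K, hK, hKB⟩ := exists_norm_le_mul_norm hB hinj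
  obtain ⟨C, hC, hT⟩ := exists_taylor_one_le hψ
  obtain ⟨ε, hε, hball⟩ := Metric.mem_nhds_iff.1 hT
  -- `L` bounds `‖η‖` near `a`, so `t ≤ ε / (2 * L)` keeps `(u, t • η)` in the Taylor ball. The
  -- bound `t ≤ t₁` makes the Taylor error `C * K ^ 2 * t ^ 2 * ‖F u‖ ^ 2` fit into the slack `2 *
  -- (1 - σ) * t * ψ (u, 0)`, because `c * ‖F u‖ ^ 2 ≤ ψ (u, 0)`.
  set L : ℝ := K * (‖F a‖ + 1)
  have hL : 0 < L := by positivity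
  have hFL : ∀ᶠ u in 𝓝 a, ‖F u‖ < ‖F a‖ + 1 :=
    hF.norm.eventually (Iio_mem_nhds (lt_add_one _))
  set t₁ : ℝ := 2 * (1 - σ) * c / (C * K ^ 2 + 1)
  have ht₁ : 0 < t₁ := by
    have : 0 < 1 - σ := by linarith
    positivity
  refine ⟨min (ε / (2 * L)) t₁, lt_min (by positivity) ht₁, ?_⟩
  filter_upwards [hKB, hFL, hlow, hd, Metric.ball_mem_nhds a hε] with u h1 h2 h3 h4 h5 η hη t ht htle
  have hη1 : ‖η‖ ≤ K * ‖F u‖ := by simpa [hη] using h1 η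
  have hη2 : ‖η‖ ≤ L := hη1.trans (mul_le_mul_of_nonneg_left h2.le hK.le)
  have htη : ‖t • η‖ < ε := by
    rw [norm_smul, Real.norm_of_nonneg ht.le]
    calc t * ‖η‖ ≤ ε / (2 * L) * L := by
          gcongr
          exact htle.trans (min_le_left _ _)
      _ = ε / 2 := by field_simp
      _ < ε := by linarith
  have hmem : (((u, 0), (u, t • η)) : (E × E) × (E × E)) ∈ Metric.ball ((a, (0 : E)), (a, (0 : E))) ε := by
    rw [Metric.mem_ball] at h5 ⊢
    simp only [Prod.dist_eq, dist_self, dist_zero_right, sup_lt_iff]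
    exact ⟨⟨h5, hε⟩, h5, htη⟩
  have h6 := hball hmem
  simp only [Set.mem_ofPred_eq, Prod.mk_sub_mk, sub_self, sub_zero] at h6
  have e1 : ((0, t • η) : E × E) = t • (0, η) := by simp
  have e2 : ‖((0, t • η) : E × E)‖ = t * ‖η‖ := by
    rw [Prod.norm_def]; simp [norm_smul, abs_of_pos ht]; positivity
  rw [e2, e1, map_smul, h4 η hη, Real.norm_eq_abs] at h6
  have h7 := (abs_le.1 h6).2
  have h8 : (t * ‖η‖) ^ 2 ≤ t ^ 2 * (K ^ 2 * ‖F u‖ ^ 2) := by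
    rw [mul_pow]
    gcongr
    rw [← mul_pow]
    gcongr
  have h9 : C * K ^ 2 * t ≤ 2 * (1 - σ) * c := by
    have : t * (C * K ^ 2 + 1) ≤ 2 * (1 - σ) * c :=
      (le_div_iff₀ (by positivity)).1 (htle.trans (min_le_right _ _))
    nlinarith
  have h10 : C * (t * ‖η‖) ^ 2 ≤ t * (2 * (1 - σ)) * ψ (u, 0) := by
    calc C * (t * ‖η‖) ^ 2 ≤ C * (t ^ 2 * (K ^ 2 * ‖F u‖ ^ 2)) := by gcongr
      _ = t * ‖F u‖ ^ 2 * (C * K ^ 2 * t) := by ring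
      _ ≤ t * ‖F u‖ ^ 2 * (2 * (1 - σ) * c) := by gcongr
      _ = t * (2 * (1 - σ)) * (c * ‖F u‖ ^ 2) := by ring
      _ ≤ _ := by
        have : 0 ≤ 1 - σ := by linarith
        gcongr
  have h11 : t • (-2 * ψ (u, 0)) = -2 * t * ψ (u, 0) := by simp; ring
  rw [h11] at h7
  nlinarith

/-- Since `‖η‖ ≤ K * ‖F u‖` and `F` vanishes at `a`, Newton steps of bounded length factor shrink to
zero as `u → a`. -/
theorem eventually_step_mem {N : Set (E × E)} (hN : N ∈ 𝓝 (a, (0 : E)))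
    (hF : ContinuousAt F a) (hF0 : F a = 0) (hB : ContinuousAt B a)
    (hinj : Function.Injective (B a)) (T : ℝ) :
    ∀ᶠ u in 𝓝 a, ∀ η, B u η = -F u → ∀ t, 0 ≤ t → t ≤ T → (u, t • η) ∈ N := by
  obtain ⟨K, hK, hKB⟩ := exists_norm_le_mul_norm hB hinj
  obtain ⟨ε, hε, hball⟩ := Metric.mem_nhds_iff.1 hN
  have hlim : Tendsto (fun u => T * (K * ‖F u‖)) (𝓝 a) (𝓝 0) := by
    have := (hF.norm.tendsto.const_mul K).const_mul T
    simpa [hF0] using this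
  filter_upwards [hKB, hlim.eventually (gt_mem_nhds hε), Metric.ball_mem_nhds a hε]
    with u h1 h2 h3 η hη t ht htT
  apply hball
  simp only [Metric.mem_ball, Prod.dist_eq, dist_zero_right, sup_lt_iff]
  refine ⟨h3, lt_of_le_of_lt ?_ h2⟩
  rw [norm_smul, Real.norm_of_nonneg ht]
  have : ‖η‖ ≤ K * ‖F u‖ := by simpa [hη] using h1 η
  have hT : 0 ≤ T := ht.trans htT
  gcongr

/-- Applying `B u` to `η + (u - a)` leaves the Taylor remainder of `F` and `(B u - B a) (u - a)`,
both quadratic; uniform injectivity of `B u` carries the bound back. The forms `B` and `DF` have to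
agree only at `a`, so the connection terms elsewhere do no harm. -/
theorem exists_newton_direction_le (hF : ContDiffAt ℝ 2 F a) (hF0 : F a = 0)
    (hB : DifferentiableAt ℝ B a) (hBF : B a = fderiv ℝ F a) (hinj : Function.Injective (B a)) :
    ∃ C : ℝ, 0 ≤ C ∧ ∀ᶠ u in 𝓝 a, ∀ η, B u η = -F u → ‖η + (u - a)‖ ≤ C * ‖u - a‖ ^ 2 := by
  obtain ⟨K, hK, hKB⟩ := exists_norm_le_mul_norm hB.continuousAt hinj
  obtain ⟨C, hC, hT⟩ := exists_taylor_one_at_le hF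
  obtain ⟨C', hC', hB'⟩ := hB.isBigO_sub.exists_nonneg
  refine ⟨K * (C + C'), by positivity, ?_⟩
  filter_upwards [hKB, hT, hB'.bound] with u h1 h2 h3 η hη
  refine (h1 _).trans ?_
  rw [mul_assoc]
  gcongr
  have e : B u (η + (u - a)) = -(F u - F a - fderiv ℝ F a (u - a)) + (B u - B a) (u - a) := by
    rw [map_add, hη, hF0, ← hBF]; simp; abel
  rw [e]
  calc _ ≤ ‖F u - F a - fderiv ℝ F a (u - a)‖ + ‖(B u - B a) (u - a)‖ := by
        refine (norm_add_le _ _).trans_eq ?_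
        rw [norm_neg]
    _ ≤ C * ‖u - a‖ ^ 2 + C' * ‖u - a‖ * ‖u - a‖ := by
        gcongr
        exact (ContinuousLinearMap.le_opNorm _ _).trans (by gcongr)
    _ = _ := by ring

omit [FiniteDimensional ℝ E] in
theorem exists_retraction_sub_le {r : E × E → E} (hr : ContDiffAt ℝ 2 r (a, 0))
    (hr0 : ∀ᶠ u in 𝓝 a, r (u, 0) = u)
    (hr1 : ∀ᶠ u in 𝓝 a, ∀ w, fderiv ℝ r (u, 0) (0, w) = w) :
    ∃ C : ℝ, 0 ≤ C ∧ ∀ᶠ p : E × E in 𝓝 (a, 0), ‖r p - p.1 - p.2‖ ≤ C * ‖p.2‖ ^ 2 := by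
  obtain ⟨C, hC, hT⟩ := exists_taylor_one_le hr
  refine ⟨C, hC, ?_⟩
  have ht : Tendsto (fun p : E × E => ((p.1, (0 : E)), p)) (𝓝 (a, 0)) (𝓝 ((a, 0), (a, 0))) := by
    have : Continuous (fun p : E × E => ((p.1, (0 : E)), p)) := by fun_prop
    exact this.tendsto (a, 0)
  have hfst : Tendsto (fun p : E × E => p.1) (𝓝 (a, 0)) (𝓝 a) := continuous_fst.tendsto (a, (0 : E))
  filter_upwards [ht.eventually hT, hfst.eventually hr0, hfst.eventually hr1] with p h1 h2 h3
  have e : p - (p.1, (0 : E)) = (0, p.2) := by ext <;> simp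
  have e2 : ‖((0, p.2) : E × E)‖ = ‖p.2‖ := by
    rw [Prod.norm_def]; simp
  simpa only [e, h2, h3, e2] using h1

/-- The error splits into the deviation of the retraction from `u + tη` and `t` times the deviation
of `η` from `-(u - a)`. For `t = 1` the linear term drops out, which is the quadratic contraction.
-/
theorem exists_step_sub_le {r : E × E → E} (hr : ContDiffAt ℝ 2 r (a, 0))
    (hr0 : ∀ᶠ u in 𝓝 a, r (u, 0) = u)
    (hr1 : ∀ᶠ u in 𝓝 a, ∀ w, fderiv ℝ r (u, 0) (0, w) = w)
    (hF : ContDiffAt ℝ 2 F a) (hF0 : F a = 0)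
    (hB : DifferentiableAt ℝ B a) (hBF : B a = fderiv ℝ F a) (hinj : Function.Injective (B a))
    (t : ℝ) (ht : 0 ≤ t) :
    ∃ C : ℝ, 0 ≤ C ∧ ∀ᶠ u in 𝓝 a, ∀ η, B u η = -F u →
      ‖r (u, t • η) - a - (1 - t) • (u - a)‖ ≤ C * ‖u - a‖ ^ 2 := by
  obtain ⟨C₁, hC₁, h1⟩ := exists_newton_direction_le hF hF0 hB hBF hinj
  obtain ⟨C₂, hC₂, h2⟩ := exists_retraction_sub_le hr hr0 hr1
  have h3 := eventually_step_mem h2 hF.continuousAt hF0 hB.continuousAt hinj t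
  refine ⟨C₂ * (t * (1 + C₁)) ^ 2 + t * C₁, by positivity, ?_⟩
  filter_upwards [h1, h3, Metric.ball_mem_nhds a one_pos] with u h1 h3 h4 η hη
  rw [mem_ball_iff_norm] at h4
  have h5 := h1 η hη
  have h6 := h3 η hη t ht le_rfl
  have h7 : ‖η‖ ≤ (1 + C₁) * ‖u - a‖ := by
    calc ‖η‖ = ‖(η + (u - a)) - (u - a)‖ := by simp
      _ ≤ ‖η + (u - a)‖ + ‖u - a‖ := norm_sub_le _ _
      _ ≤ C₁ * ‖u - a‖ ^ 2 + ‖u - a‖ := by gcongr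
      _ ≤ C₁ * ‖u - a‖ + ‖u - a‖ := by
        gcongr
        nlinarith [norm_nonneg (u - a)]
      _ = _ := by ring
  have e : r (u, t • η) - a - (1 - t) • (u - a) =
      (r (u, t • η) - u - t • η) + t • (η + (u - a)) := by module
  rw [e]
  calc _ ≤ ‖r (u, t • η) - u - t • η‖ + ‖t • (η + (u - a))‖ := norm_add_le _ _
    _ ≤ C₂ * (t * ((1 + C₁) * ‖u - a‖)) ^ 2 + t * (C₁ * ‖u - a‖ ^ 2) := by
      rw [norm_smul, Real.norm_of_nonneg ht] at *
      refine add_le_add (h6.trans ?_) (by gcongr)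
      gcongr
    _ = _ := by ring

/-- At a nondegenerate zero `F` grows linearly, so `h` grows quadratically; this later turns cubic
errors into small relative ones. -/
theorem exists_mul_sq_le {h : E → ℝ} {c : ℝ} (hc : 0 < c)
    (hlow : ∀ᶠ u in 𝓝 a, c * ‖F u‖ ^ 2 ≤ h u)
    (hF : ContDiffAt ℝ 2 F a) (hF0 : F a = 0) (hinj : Function.Injective (fderiv ℝ F a)) :
    ∃ c' : ℝ, 0 < c' ∧ ∀ᶠ u in 𝓝 a, c' * ‖u - a‖ ^ 2 ≤ h u := by
  obtain ⟨K, hK, hKB⟩ := exists_norm_le_mul_norm (B := fun _ : E => fderiv ℝ F a) (z := a)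
    continuousAt_const hinj
  obtain ⟨C, hC, hT⟩ := exists_taylor_one_at_le hF
  refine ⟨c / (2 * K) ^ 2, by positivity, ?_⟩
  -- Within this radius `K * C * ‖u - a‖ ^ 2` is at most half of `‖u - a‖` and can be absorbed on
  -- the left.
  have hδ : (0 : ℝ) < 1 / (2 * (K * C + 1)) := by positivity
  filter_upwards [hlow, hKB, hT, Metric.ball_mem_nhds a hδ] with u h1 h2 h3 h4
  rw [mem_ball_iff_norm, lt_div_iff₀ (by positivity)] at h4
  have h5 := h2 (u - a)
  have h6 : ‖fderiv ℝ F a (u - a)‖ ≤ ‖F u‖ + C * ‖u - a‖ ^ 2 := by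
    calc _ = ‖F u - (F u - F a - fderiv ℝ F a (u - a))‖ := by rw [hF0]; simp
      _ ≤ _ := (norm_sub_le _ _).trans (by gcongr)
  have h7 : ‖u - a‖ ≤ 2 * K * ‖F u‖ := by
    have : ‖u - a‖ ≤ K * (‖F u‖ + C * ‖u - a‖ ^ 2) := h5.trans (by gcongr)
    nlinarith [norm_nonneg (u - a), sq_nonneg ‖u - a‖]
  calc _ ≤ c / (2 * K) ^ 2 * (2 * K * ‖F u‖) ^ 2 := by gcongr
    _ = c * ‖F u‖ ^ 2 := by field_simp
    _ ≤ _ := h1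

/-- Near a nondegenerate zero, a step of length `t` in the Newton direction multiplies the merit
function by `(1 - t) ^ 2` up to a small relative error. -/
theorem eventually_merit_step {r : E × E → E} (hr : ContDiffAt ℝ 2 r (a, 0))
    (hr0 : ∀ᶠ u in 𝓝 a, r (u, 0) = u)
    (hr1 : ∀ᶠ u in 𝓝 a, ∀ w, fderiv ℝ r (u, 0) (0, w) = w)
    (hF : ContDiffAt ℝ 2 F a) (hF0 : F a = 0)
    (hB : DifferentiableAt ℝ B a) (hBF : B a = fderiv ℝ F a) (hinj : Function.Injective (B a))
    {h : E → ℝ} {c : ℝ} (hh : ContDiffAt ℝ 3 h a) (hh0 : h a = 0) (hc : 0 < c)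
    (hlow : ∀ᶠ u in 𝓝 a, c * ‖F u‖ ^ 2 ≤ h u) (t : ℝ) (ht : 0 ≤ t) {ε : ℝ} (hε : 0 < ε) :
    ∀ᶠ u in 𝓝 a, ∀ η, B u η = -F u → |h (r (u, t • η)) - (1 - t) ^ 2 * h u| ≤ ε * h u := by
  -- Nonnegativity of `h` makes its zero a critical point, so the Taylor model is purely quadratic.
  have hmin : IsLocalMin h a := by
    filter_upwards [hlow] with u hu
    rw [hh0]
    exact le_trans (by positivity) hu
  obtain ⟨C₁, hC₁, h1⟩ := exists_taylor_two_le hh hh0 hmin.fderiv_eq_zero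
  obtain ⟨C₂, hC₂, h2⟩ := exists_step_sub_le hr hr0 hr1 hF hF0 hB hBF hinj t ht
  obtain ⟨c', hc', h3⟩ := exists_mul_sq_le hc hlow hF hF0 (hBF ▸ hinj)
  set D := fderiv ℝ (fderiv ℝ h) a
  have hra : Tendsto r (𝓝 (a, 0)) (𝓝 a) := by
    have := hr.continuousAt.tendsto
    rwa [hr0.self_of_nhds] at this
  have h4 := eventually_step_mem (hra.eventually h1) hF.continuousAt hF0 hB.continuousAt hinj t
  set s : ℝ := |1 - t|
  set S : ℝ := s + C₂
  have hS : 0 ≤ S := by positivity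
  -- `Q` collects the cubic errors: the two Taylor remainders of `h`, at the new and at the old
  -- point, and the change of the quadratic form when the new error `y` is replaced by `(1 - t) •
  -- d`.
  set Q : ℝ := C₁ * S ^ 3 + C₁ * s ^ 2 + ‖D‖ * (S + s) * C₂
  have hQ : 0 ≤ Q := by positivity
  have hδ : (0 : ℝ) < ε * c' / (Q + 1) := by positivity
  filter_upwards [h1, h2, h3, h4, Metric.ball_mem_nhds a one_pos, Metric.ball_mem_nhds a hδ]
    with u h1 h2 h3 h4 h5 h6 η hη
  rw [mem_ball_iff_norm] at h5 h6
  rw [lt_div_iff₀ (by positivity)] at h6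
  have k1 := h2 η hη
  have k2 := h4 η hη t ht le_rfl
  set d := u - a
  set y := r (u, t • η) - a
  set z := (1 - t) • d
  have hz : ‖z‖ = s * ‖d‖ := by rw [norm_smul, Real.norm_eq_abs]
  have hy : ‖y‖ ≤ S * ‖d‖ := by
    calc ‖y‖ = ‖z + (y - z)‖ := by simp
      _ ≤ s * ‖d‖ + C₂ * ‖d‖ ^ 2 := (norm_add_le _ _).trans (by rw [hz]; gcongr)
      _ ≤ s * ‖d‖ + C₂ * ‖d‖ := by
        gcongr
        nlinarith [norm_nonneg d]
      _ = _ := by ring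
  have hq : |D y y - D z z| ≤ ‖D‖ * (S + s) * C₂ * ‖d‖ ^ 3 := by
    have e : D y y - D z z = D y (y - z) + D (y - z) z := by simp
    rw [e]
    calc _ ≤ ‖D y (y - z)‖ + ‖D (y - z) z‖ := norm_add_le _ _
      _ ≤ ‖D‖ * ‖y‖ * ‖y - z‖ + ‖D‖ * ‖y - z‖ * ‖z‖ :=
        add_le_add (D.le_opNorm₂ _ _) (D.le_opNorm₂ _ _)
      _ ≤ ‖D‖ * (S * ‖d‖) * (C₂ * ‖d‖ ^ 2) + ‖D‖ * (C₂ * ‖d‖ ^ 2) * (s * ‖d‖) := by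
        rw [hz]; gcongr
      _ = _ := by ring
  have hDz : D z z = (1 - t) ^ 2 * D d d := by simp [z]; ring
  have hs2 : s ^ 2 = (1 - t) ^ 2 := sq_abs _
  have hmain : |h (r (u, t • η)) - (1 - t) ^ 2 * h u| ≤ Q * ‖d‖ ^ 3 := by
    have e : h (r (u, t • η)) - (1 - t) ^ 2 * h u =
        (h (r (u, t • η)) - 1 / 2 * D y y) - (1 - t) ^ 2 * (h u - 1 / 2 * D d d)
          + 1 / 2 * (D y y - D z z) := by rw [hDz]; ring
    rw [e]
    calc _ ≤ |h (r (u, t • η)) - 1 / 2 * D y y| + (1 - t) ^ 2 * |h u - 1 / 2 * D d d|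
          + 1 / 2 * |D y y - D z z| := by
          refine (abs_add_le _ _).trans (add_le_add ((abs_sub _ _).trans ?_) ?_)
          · rw [abs_mul, abs_of_nonneg (sq_nonneg (1 - t))]
          · rw [abs_mul, abs_of_pos (by norm_num : (0 : ℝ) < 1 / 2)]
      _ ≤ C₁ * (S * ‖d‖) ^ 3 + (1 - t) ^ 2 * (C₁ * ‖d‖ ^ 3)
          + 1 * (‖D‖ * (S + s) * C₂ * ‖d‖ ^ 3) := by
          refine add_le_add (add_le_add (k2.trans (by gcongr)) (by gcongr)) ?_
          gcongr
          norm_num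
      _ = _ := by rw [← hs2]; ring
  calc _ ≤ Q * ‖d‖ ^ 3 := hmain
    _ = (Q * ‖d‖) * ‖d‖ ^ 2 := by ring
    _ ≤ (ε * c') * ‖d‖ ^ 2 := by
      refine mul_le_mul_of_nonneg_right ?_ (sq_nonneg _)
      nlinarith [norm_nonneg d]
    _ = ε * (c' * ‖d‖ ^ 2) := by ring
    _ ≤ _ := by gcongr

end LocalModel

/-! ### Vector fields and differentials in the chart at a point -/

section Coordinates

variable {E : Type*} [NormedAddCommGroup E] [NormedSpace ℝ E]
  {M : Type*} [TopologicalSpace M] [ChartedSpace E M] [IsManifold 𝓘(ℝ, E) ∞ M]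

/-- The coordinate vector field with constant value `w` in the chart at `p`. -/
def coordField (p : M) (w : E) (x : M) : TangentSpace 𝓘(ℝ, E) x :=
  (trivializationAt E (TangentSpace 𝓘(ℝ, E)) p).symmL ℝ x w

/-- The coordinates in the chart at `p` of a tangent vector. -/
def coordVec (p x : M) : TangentSpace 𝓘(ℝ, E) x →L[ℝ] E :=
  (trivializationAt E (TangentSpace 𝓘(ℝ, E)) p).continuousLinearMapAt ℝ x

theorem coordField_coordVec {p x : M} (hx : x ∈ (chartAt E p).source)
    (v : TangentSpace 𝓘(ℝ, E) x) : coordField p (coordVec p x v) x = v :=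
  (trivializationAt E (TangentSpace 𝓘(ℝ, E)) p).symmL_continuousLinearMapAt (by simpa using hx) v

theorem coordVec_coordField {p x : M} (hx : x ∈ (chartAt E p).source) (w : E) :
    coordVec p x (coordField p w x) = w :=
  (trivializationAt E (TangentSpace 𝓘(ℝ, E)) p).continuousLinearMapAt_symmL (by simpa using hx) w

theorem trivializationAt_snd_eq_coordVec {p x : M} (hx : x ∈ (chartAt E p).source)
    (v : TangentSpace 𝓘(ℝ, E) x) :
    (trivializationAt E (TangentSpace 𝓘(ℝ, E)) p ⟨x, v⟩).2 = coordVec p x v := by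
  have := (trivializationAt E (TangentSpace 𝓘(ℝ, E)) p).coe_linearMapAt_of_mem (R := ℝ) (b := x) (by simpa using hx)
  exact (congrFun this v).symm

theorem contMDiffAt_section_iff_coordVec {p x : M} (hx : x ∈ (chartAt E p).source)
    {X : Π x : M, TangentSpace 𝓘(ℝ, E) x} :
    CMDiffAt ∞ (T% X) x ↔ CMDiffAt ∞ (fun y => coordVec p y (X y)) x := by
  rw [(trivializationAt E (TangentSpace 𝓘(ℝ, E)) p).contMDiffAt_section_iff (by simpa using hx)]
  apply Filter.EventuallyEq.contMDiffAt_iff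
  filter_upwards [(chartAt E p).open_source.mem_nhds hx] with y hy
  exact trivializationAt_snd_eq_coordVec hy _

theorem contMDiffAt_coordField {p x : M} (hx : x ∈ (chartAt E p).source) (w : E) :
    CMDiffAt ∞ (T% (coordField p w)) x := by
  rw [contMDiffAt_section_iff_coordVec hx]
  refine (contMDiffAt_const (c := w)).congr_of_eventuallyEq ?_
  filter_upwards [(chartAt E p).open_source.mem_nhds hx] with y hy
  exact coordVec_coordField hy w

theorem contDiffAt_comp_extChartAt_symm {G : Type*} [NormedAddCommGroup G] [NormedSpace ℝ G]
    {p x : M} (hx : x ∈ (chartAt E p).source) {g : M → G}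
    (hg : CMDiffAt ∞ g x) :
    ContDiffAt ℝ ∞ (g ∘ (extChartAt 𝓘(ℝ, E) p).symm) (extChartAt 𝓘(ℝ, E) p x) := by
  rw [← contMDiffAt_iff_contDiffAt]
  have hx' : x ∈ (extChartAt 𝓘(ℝ, E) p).source := by simpa using hx
  refine ContMDiffAt.comp (I' := 𝓘(ℝ, E)) _ ?_ ?_
  · rwa [(extChartAt 𝓘(ℝ, E) p).left_inv hx']
  · exact (contMDiffOn_extChartAt_symm p).contMDiffAt
      ((isOpen_extChartAt_target p).mem_nhds ((extChartAt 𝓘(ℝ, E) p).map_source hx'))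

theorem mvfderiv_eq_fderiv_coordVec {p x : M} (hx : x ∈ (chartAt E p).source) {g : M → ℝ}
    (hg : MDiffAt g x) (v : TangentSpace 𝓘(ℝ, E) x) :
    d% g x v = fderiv ℝ (g ∘ (extChartAt 𝓘(ℝ, E) p).symm) (extChartAt 𝓘(ℝ, E) p x)
      (coordVec p x v) := by
  have hx' : x ∈ (extChartAt 𝓘(ℝ, E) p).source := by simpa using hx
  have h1 : MDiffAt (g ∘ (extChartAt 𝓘(ℝ, E) p).symm) (extChartAt 𝓘(ℝ, E) p x) := by
    refine MDifferentiableAt.comp (I' := 𝓘(ℝ, E)) _ ?_ ?_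
    · rwa [(extChartAt 𝓘(ℝ, E) p).left_inv hx']
    · exact ((contMDiffOn_extChartAt_symm (n := 1) p).contMDiffAt
        ((isOpen_extChartAt_target p).mem_nhds
          ((extChartAt 𝓘(ℝ, E) p).map_source hx'))).mdifferentiableAt (by simp)
  have h2 : d% g x = d% ((g ∘ (extChartAt 𝓘(ℝ, E) p).symm) ∘ extChartAt 𝓘(ℝ, E) p) x := by
    refine Filter.EventuallyEq.mfderiv_eq ?_
    filter_upwards [(chartAt E p).open_source.mem_nhds hx] with y hy
    simp [hy]
  rw [h2, mvfderiv_comp_apply x h1 (mdifferentiableAt_extChartAt hx),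
    coordVec, TangentBundle.continuousLinearMapAt_trivializationAt hx]
  have h3 := mfderiv_eq_fderiv (𝕜 := ℝ) (f := g ∘ (extChartAt 𝓘(ℝ, E) p).symm) (x := extChartAt 𝓘(ℝ, E) p x)
  exact congrArg (fun A : E →L[ℝ] ℝ => A (mfderiv% (extChartAt 𝓘(ℝ, E) p) x v)) h3

/-- In a chart this is the Fréchet derivative of a smooth function applied to the smooth components
of the field. Smoothness of `g` at `x` gives differentiability nearby, so the coordinate formula
holds on a neighbourhood. -/
theorem contMDiffAt_mvfderiv_apply {x : M} {g : M → ℝ}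
    (hg : CMDiffAt ∞ g x) {X : Π x : M, TangentSpace 𝓘(ℝ, E) x} (hX : CMDiffAt ∞ (T% X) x) :
    CMDiffAt ∞ (fun y => d% g y (X y)) x := by
  have hx := mem_chart_source E x
  rw [contMDiffAt_section_iff_coordVec hx] at hX
  have h1 := (contDiffAt_comp_extChartAt_symm hx hg).fderiv_right (m := ∞) (by simp)
  have h2 := ContMDiffAt.comp x h1.contMDiffAt (contMDiffAt_extChartAt' (I := 𝓘(ℝ, E)) (n := ∞) hx)
  have h3 := (contMDiffAt_iff_contMDiffAt_nhds (n := 1) (by simp)).1 (hg.of_le (by simp))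
  refine (h2.clm_apply hX).congr_of_eventuallyEq ?_
  filter_upwards [(chartAt E x).open_source.mem_nhds hx, h3] with y hy hgy
  exact mvfderiv_eq_fderiv_coordVec hy (hgy.mdifferentiableAt (by simp)) (X y)

end Coordinates


/-! ### Metric, gradient and Hessian in coordinates -/

section Forms

variable {E : Type*} [NormedAddCommGroup E] [NormedSpace ℝ E] [FiniteDimensional ℝ E]
  {M : Type*} [TopologicalSpace M] [ChartedSpace E M] [IsManifold 𝓘(ℝ, E) ∞ M]
  [RiemannianBundle (fun x : M => TangentSpace 𝓘(ℝ, E) x)]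

/-- The bilinear form `(v, w) ↦ ⟨A v, w⟩` written in the chart at `p`. -/
def coordForm (p : M) (A : Π x : M, TangentSpace 𝓘(ℝ, E) x →L[ℝ] TangentSpace 𝓘(ℝ, E) x)
    (u : E) : E →L[ℝ] E →L[ℝ] ℝ :=
  LinearMap.toContinuousLinearMap
    { toFun := fun w₁ =>
        (innerSL ℝ (A ((extChartAt 𝓘(ℝ, E) p).symm u)
          (coordField p w₁ ((extChartAt 𝓘(ℝ, E) p).symm u)))).comp
        ((trivializationAt E (TangentSpace 𝓘(ℝ, E)) p).symmL ℝ ((extChartAt 𝓘(ℝ, E) p).symm u))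
      map_add' := fun v w => by
        have h : ∀ x : M, coordField p (v + w) x = coordField p v x + coordField p w x :=
          fun x => map_add _ v w
        rw [h, map_add, map_add, ContinuousLinearMap.add_comp]
      map_smul' := fun c w => by
        have h : ∀ x : M, coordField p (c • w) x = c • coordField p w x :=
          fun x => map_smul _ c w
        rw [h, map_smul, map_smul, ContinuousLinearMap.smul_comp]
        rfl }

theorem coordForm_apply (p : M) (A : Π x : M, TangentSpace 𝓘(ℝ, E) x →L[ℝ] TangentSpace 𝓘(ℝ, E) x)
    (u w₁ w₂ : E) :
    coordForm p A u w₁ w₂ = inner ℝ (A ((extChartAt 𝓘(ℝ, E) p).symm u)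
      (coordField p w₁ ((extChartAt 𝓘(ℝ, E) p).symm u)))
      (coordField p w₂ ((extChartAt 𝓘(ℝ, E) p).symm u)) := rfl

theorem coordForm_extChartAt_apply {p x : M} (hx : x ∈ (chartAt E p).source)
    (A : Π x : M, TangentSpace 𝓘(ℝ, E) x →L[ℝ] TangentSpace 𝓘(ℝ, E) x) (w₁ w₂ : E) :
    coordForm p A (extChartAt 𝓘(ℝ, E) p x) w₁ w₂ =
      inner ℝ (A x (coordField p w₁ x)) (coordField p w₂ x) := by
  have hx' : (extChartAt 𝓘(ℝ, E) p).symm (extChartAt 𝓘(ℝ, E) p x) = x := by simp [hx]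
  rw [coordForm_apply, hx']

/-- In finite dimension, smoothness of a form-valued map can be tested on each pair of vectors. The
test is one on a set, so the entries are taken smooth on the whole chart domain. -/
theorem contDiffAt_coordForm {p x : M} (hx : x ∈ (chartAt E p).source)
    {A : Π x : M, TangentSpace 𝓘(ℝ, E) x →L[ℝ] TangentSpace 𝓘(ℝ, E) x}
    (hA : ∀ w₁ w₂ : E, ∀ y ∈ (chartAt E p).source,
      CMDiffAt ∞ (fun y => inner ℝ (A y (coordField p w₁ y)) (coordField p w₂ y)) y) :
    ContDiffAt ℝ ∞ (coordForm p A) (extChartAt 𝓘(ℝ, E) p x) := by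
  have h : ContDiffOn ℝ ∞ (coordForm p A) (extChartAt 𝓘(ℝ, E) p).target := by
    refine contDiffOn_clm_apply.2 fun w₁ => contDiffOn_clm_apply.2 fun w₂ => ?_
    intro u hu
    have hu' := (extChartAt 𝓘(ℝ, E) p).map_target hu
    rw [extChartAt_source] at hu'
    have := contDiffAt_comp_extChartAt_symm hu' (hA w₁ w₂ _ hu')
    rw [(extChartAt 𝓘(ℝ, E) p).right_inv hu] at this
    exact this.contDiffWithinAt
  exact h.contDiffAt ((isOpen_extChartAt_target p).mem_nhds
    ((extChartAt 𝓘(ℝ, E) p).map_source (by simpa using hx)))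

theorem coordForm_injective {p x : M} (hx : x ∈ (chartAt E p).source)
    {A : Π x : M, TangentSpace 𝓘(ℝ, E) x →L[ℝ] TangentSpace 𝓘(ℝ, E) x}
    (hA : Function.Injective (A x)) :
    Function.Injective (coordForm p A (extChartAt 𝓘(ℝ, E) p x)) := by
  rw [injective_iff_map_eq_zero]
  intro w hw
  have h1 : ∀ v : TangentSpace 𝓘(ℝ, E) x, inner ℝ (A x (coordField p w x)) v = 0 := by
    intro v
    have := congrArg (fun L : E →L[ℝ] ℝ => L (coordVec p x v)) hw
    rwa [coordForm_extChartAt_apply hx, coordField_coordVec hx] at this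
  have h2 := hA ((inner_self_eq_zero (𝕜 := ℝ)).1 (h1 _) |>.trans (map_zero _).symm)
  rw [← coordVec_coordField hx w, h2, map_zero]

variable [IsContMDiffRiemannianBundle 𝓘(ℝ, E) ∞ E (fun x : M => TangentSpace 𝓘(ℝ, E) x)]

omit [FiniteDimensional ℝ E] in
theorem contMDiffAt_inner {X Y : Π x : M, TangentSpace 𝓘(ℝ, E) x} {x : M}
    (hX : CMDiffAt ∞ (T% X) x) (hY : CMDiffAt ∞ (T% Y) x) :
    CMDiffAt ∞ (fun y => inner ℝ (X y) (Y y)) x :=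
  ContMDiffAt.inner_bundle (F := E) (E := fun x : M => TangentSpace 𝓘(ℝ, E) x)
    (IB := 𝓘(ℝ, E)) (b := fun y => y) hX hY

/-- In coordinates the gradient is the inverse of the Gram form applied to the differential, and
inversion of operators is smooth at an invertible one. -/
theorem contMDiffAt_grad {f : M → ℝ} (hf : ContMDiff 𝓘(ℝ, E) 𝓘(ℝ, ℝ) ∞ f) (x : M) :
    CMDiffAt ∞ (T% (fun y => grad (E := E) f y)) x := by
  have hx := mem_chart_source E x
  rw [contMDiffAt_section_iff_coordVec hx]
  set φ := extChartAt 𝓘(ℝ, E) x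
  set g : E → E →L[ℝ] E →L[ℝ] ℝ := coordForm x fun y => ContinuousLinearMap.id ℝ _
  have hg : ContDiffAt ℝ ∞ g (φ x) :=
    contDiffAt_coordForm hx fun w₁ w₂ y hy =>
      contMDiffAt_inner (contMDiffAt_coordField hy w₁) (contMDiffAt_coordField hy w₂)
  have hgi : ∀ y ∈ (chartAt E x).source, Function.Injective (g (φ y)) := fun y hy =>
    coordForm_injective hy Function.injective_id
  have hequiv : ∀ y ∈ (chartAt E x).source, ∃ L : E ≃L[ℝ] (E →L[ℝ] ℝ), (L : E →L[ℝ] E →L[ℝ] ℝ) = g (φ y) := by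
    intro y hy
    have hfin : Module.finrank ℝ E = Module.finrank ℝ (E →L[ℝ] ℝ) := by
      rw [← (LinearMap.toContinuousLinearMap (𝕜 := ℝ) (E := E) (F' := ℝ)).finrank_eq]
      exact Subspace.dual_finrank_eq.symm
    refine ⟨(LinearEquiv.ofInjectiveOfFinrankEq (g (φ y)).toLinearMap (hgi y hy) hfin).toContinuousLinearEquiv, ?_⟩
    ext; rfl
  have hgrad : ∀ y ∈ (chartAt E x).source, coordVec x y (grad f y) =
      (g (φ y)).inverse (fderiv ℝ (f ∘ φ.symm) (φ y)) := by
    intro y hy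
    obtain ⟨L, hL⟩ := hequiv y hy
    rw [← hL, ContinuousLinearMap.inverse_equiv]
    refine (L.eq_symm_apply).2 ?_
    ext w
    change (L : E →L[ℝ] E →L[ℝ] ℝ) _ w = _
    rw [hL, coordForm_extChartAt_apply hy, coordField_coordVec hy, ContinuousLinearMap.id_apply,
      inner_grad,
      mvfderiv_eq_fderiv_coordVec hy (hf.mdifferentiableAt (by simp)), coordVec_coordField hy]
  obtain ⟨L, hL⟩ := hequiv x hx
  have h1 : ContDiffAt ℝ ∞ (fun u => (g u).inverse (fderiv ℝ (f ∘ φ.symm) u)) (φ x) := by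
    have hi : ContDiffAt ℝ ∞ ContinuousLinearMap.inverse (g (φ x)) := by
      rw [← hL]
      exact contDiffAt_map_inverse L
    refine (hi.comp (φ x) hg).clm_apply ?_
    exact (contDiffAt_comp_extChartAt_symm hx hf.contMDiffAt).fderiv_right (by simp)
  have h2 := ContMDiffAt.comp x h1.contMDiffAt (contMDiffAt_extChartAt' (I := 𝓘(ℝ, E)) (n := ∞) hx)
  refine h2.congr_of_eventuallyEq ?_
  filter_upwards [(chartAt E x).open_source.mem_nhds hx] with y hy using hgrad y hy

theorem contMDiffAt_koszul {X Y Z : Π x : M, TangentSpace 𝓘(ℝ, E) x} {x : M}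
    (hX : CMDiffAt ∞ (T% X) x) (hY : CMDiffAt ∞ (T% Y) x) (hZ : CMDiffAt ∞ (T% Z) x) :
    CMDiffAt ∞ (koszul X Y Z) x := by
  have hb {U V : Π x : M, TangentSpace 𝓘(ℝ, E) x} (hU : CMDiffAt ∞ (T% U) x)
      (hV : CMDiffAt ∞ (T% V) x) :
      CMDiffAt ∞ (T% (VectorField.mlieBracket 𝓘(ℝ, E) U V)) x := by
    have : IsManifold 𝓘(ℝ, E) (minSmoothness ℝ 2) M := by
      rw [minSmoothness_of_isRCLikeNormedField]
      infer_instance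
    -- The bracket costs one derivative, and `∞ + 1` is again `∞`.
    have : IsManifold 𝓘(ℝ, E) ((⊤ : ℕ∞) + 1 : WithTop ℕ∞) M :=
      inferInstanceAs (IsManifold 𝓘(ℝ, E) ∞ M)
    exact ContMDiffAt.mlieBracket_vectorField (m := ⊤) (n := ⊤) hU hV (by simp)
  unfold koszul
  exact (((((contMDiffAt_mvfderiv_apply (contMDiffAt_inner hY hZ) hX).add
    (contMDiffAt_mvfderiv_apply (contMDiffAt_inner hZ hX) hY)).sub
    (contMDiffAt_mvfderiv_apply (contMDiffAt_inner hX hY) hZ)).add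
    (contMDiffAt_inner (hb hX hY) hZ)).sub (contMDiffAt_inner (hb hY hZ) hX)).add
    (contMDiffAt_inner (hb hZ hX) hY)

/-- The Koszul formula with `Y = grad f` expresses these entries through differentials, inner
products and brackets of smooth fields. -/
theorem contMDiffAt_inner_hess {f : M → ℝ} (hf : ContMDiff 𝓘(ℝ, E) 𝓘(ℝ, ℝ) ∞ f) {p x : M}
    (hx : x ∈ (chartAt E p).source) (w₁ w₂ : E) :
    CMDiffAt ∞ (fun y => inner ℝ (hess f y (coordField p w₁ y)) (coordField p w₂ y)) x := by
  have h := (contMDiffAt_koszul (contMDiffAt_coordField hx w₁) (contMDiffAt_grad hf x)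
    (contMDiffAt_coordField hx w₂)).div_const (2 : ℝ)
  refine h.congr_of_eventuallyEq ?_
  filter_upwards [(chartAt E p).open_source.mem_nhds hx] with y hy
  exact inner_leviCivitaFun ((contMDiffAt_coordField hy w₁).mdifferentiableAt (by simp))
    ((contMDiffAt_grad hf y).mdifferentiableAt (by simp))
    ((contMDiffAt_coordField hy w₂).mdifferentiableAt (by simp))

theorem contDiffAt_coordForm_hess {f : M → ℝ} (hf : ContMDiff 𝓘(ℝ, E) 𝓘(ℝ, ℝ) ∞ f) {p x : M}
    (hx : x ∈ (chartAt E p).source) :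
    ContDiffAt ℝ ∞ (coordForm p (hess f)) (extChartAt 𝓘(ℝ, E) p x) :=
  contDiffAt_coordForm hx fun w₁ w₂ _ hy => contMDiffAt_inner_hess hf hy w₁ w₂

theorem contMDiff_merit {f : M → ℝ} (hf : ContMDiff 𝓘(ℝ, E) 𝓘(ℝ, ℝ) ∞ f) :
    ContMDiff 𝓘(ℝ, E) 𝓘(ℝ, ℝ) ∞ (merit (E := E) f) := by
  intro x
  refine (contMDiffAt_inner (contMDiffAt_grad hf x) (contMDiffAt_grad hf x)).congr_of_eventuallyEq ?_
  filter_upwards with y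
  exact (real_inner_self_eq_norm_sq _).symm

/-- Metric compatibility with both arguments equal to `grad f`. -/
theorem mvfderiv_merit {f : M → ℝ} (hf : ContMDiff 𝓘(ℝ, E) 𝓘(ℝ, ℝ) ∞ f) {x : M}
    (v : TangentSpace 𝓘(ℝ, E) x) :
    d% (merit (E := E) f) x v = 2 * inner ℝ (hess f x v) (grad f x) := by
  have hX := FiberBundle.mdifferentiableAt_extend 𝓘(ℝ, E) E v
  have hG := (contMDiffAt_grad hf x).mdifferentiableAt (by simp)
  have h := leviCivita_metric hX hG hG
  have e : merit (E := E) f = fun y => inner ℝ (grad (E := E) f y) (grad f y) :=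
    funext fun y => (real_inner_self_eq_norm_sq _).symm
  rw [FiberBundle.extend_apply_self] at h
  rw [e, h, real_inner_comm (leviCivita (fun y => grad f y) x v) (grad f x), ← two_mul]
  rfl

theorem IsNewtonDirection.mvfderiv_merit {f : M → ℝ} (hf : ContMDiff 𝓘(ℝ, E) 𝓘(ℝ, ℝ) ∞ f) {x : M}
    {η : TangentSpace 𝓘(ℝ, E) x} (hη : IsNewtonDirection f x η) :
    d% (merit (E := E) f) x η = -2 * merit (E := E) f x := by
  rw [RiemNewton.mvfderiv_merit hf, hη, inner_neg_left, real_inner_self_eq_norm_sq, merit]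
  ring

/-- At a stationary point the Hessian is the second derivative in coordinates. -/
theorem coordForm_hess_eq_fderiv {f : M → ℝ} (hf : ContMDiff 𝓘(ℝ, E) 𝓘(ℝ, ℝ) ∞ f) {p : M}
    (hp : grad (E := E) f p = 0) :
    coordForm p (hess f) (extChartAt 𝓘(ℝ, E) p p) =
      fderiv ℝ (fderiv ℝ (f ∘ (extChartAt 𝓘(ℝ, E) p).symm)) (extChartAt 𝓘(ℝ, E) p p) := by
  have hx := mem_chart_source E p
  set φ := extChartAt 𝓘(ℝ, E) p
  ext w₁ w₂
  rw [coordForm_extChartAt_apply hx]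
  have hX := (contMDiffAt_coordField hx w₁).mdifferentiableAt (by simp)
  have hZ := (contMDiffAt_coordField hx w₂).mdifferentiableAt (by simp)
  have hG := (contMDiffAt_grad hf p).mdifferentiableAt (by simp)
  have h := leviCivita_metric hX hG hZ
  -- This is the only term in which the connection acts on the coordinate frame; it vanishes because
  -- `grad f p = 0`.
  have h0 : inner ℝ (grad f p) (leviCivita (coordField p w₂) p (coordField p w₁ p)) = (0 : ℝ) := by
    rw [hp]; exact inner_zero_left _
  rw [h0, add_zero] at h
  refine h.symm.trans ?_
  have hI := contMDiffAt_inner (contMDiffAt_grad hf p) (contMDiffAt_coordField hx w₂)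
  rw [mvfderiv_eq_fderiv_coordVec hx (hI.mdifferentiableAt (by simp)), coordVec_coordField hx]
  have e : ((fun y => inner ℝ (grad f y) (coordField p w₂ y)) ∘ φ.symm) =ᶠ[𝓝 (φ p)]
      fun u => fderiv ℝ (f ∘ φ.symm) u w₂ := by
    filter_upwards [(isOpen_extChartAt_target p).mem_nhds (mem_extChartAt_target p)] with u hu
    have hu' := φ.map_target hu
    rw [extChartAt_source] at hu'
    simp only [Function.comp_apply]
    rw [inner_grad, mvfderiv_eq_fderiv_coordVec hu' (hf.mdifferentiableAt (by simp)),
      coordVec_coordField hu', φ.right_inv hu]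
  rw [e.fderiv_eq, fderiv_clm_apply _ (differentiableAt_const _)]
  · simp
  · exact ((contDiffAt_comp_extChartAt_symm hx hf.contMDiffAt).fderiv_right (m := ∞)
      (by simp)).differentiableAt (by simp)

end Forms

/-! ### The retraction in coordinates -/

section RetractionCoordinates

variable {E : Type*} [NormedAddCommGroup E] [NormedSpace ℝ E]
  {M : Type*} [TopologicalSpace M] [ChartedSpace E M] [IsManifold 𝓘(ℝ, E) ∞ M]
  {G : Type*} [NormedAddCommGroup G] [NormedSpace ℝ G]

/-- The tangent vector with coordinates `z.2` at the point with coordinates `z.1`. -/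
def coordPoint (p : M) (z : E × E) : TangentBundle 𝓘(ℝ, E) M :=
  ⟨(extChartAt 𝓘(ℝ, E) p).symm z.1, coordField p z.2 ((extChartAt 𝓘(ℝ, E) p).symm z.1)⟩

theorem coordPoint_coordVec {p x : M} (hx : x ∈ (chartAt E p).source)
    (v : TangentSpace 𝓘(ℝ, E) x) :
    coordPoint p (extChartAt 𝓘(ℝ, E) p x, coordVec p x v) = ⟨x, v⟩ := by
  have hx' : (extChartAt 𝓘(ℝ, E) p).symm (extChartAt 𝓘(ℝ, E) p x) = x := by simp [hx]
  simp only [coordPoint]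
  rw [hx', coordField_coordVec hx]

theorem coordPoint_zero (p : M) (u : E) :
    coordPoint p (u, 0) = ⟨(extChartAt 𝓘(ℝ, E) p).symm u, 0⟩ := by
  simp only [coordPoint, coordField, map_zero]

theorem contMDiffAt_coordPoint {p : M} {z : E × E} (hz : z.1 ∈ (extChartAt 𝓘(ℝ, E) p).target) :
    ContMDiffAt 𝓘(ℝ, E × E) 𝓘(ℝ, E).tangent ∞ (coordPoint p) z := by
  set e := trivializationAt E (TangentSpace 𝓘(ℝ, E)) p
  have hsrc : ∀ u ∈ (extChartAt 𝓘(ℝ, E) p).target,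
      (extChartAt 𝓘(ℝ, E) p).symm u ∈ e.baseSet := fun u hu => by
    simpa [e] using (extChartAt 𝓘(ℝ, E) p).map_target hu
  have h1 : ContMDiffAt 𝓘(ℝ, E × E) 𝓘(ℝ, E) ∞
      (fun z : E × E => (extChartAt 𝓘(ℝ, E) p).symm z.1) z :=
    ContMDiffAt.comp (I' := 𝓘(ℝ, E)) z ((contMDiffOn_extChartAt_symm p).contMDiffAt
      ((isOpen_extChartAt_target p).mem_nhds hz)) contDiff_fst.contMDiff.contMDiffAt
  have h2 : ContMDiffAt 𝓘(ℝ, E × E) 𝓘(ℝ, E) ∞ (fun z : E × E => z.2) z :=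
    contDiff_snd.contMDiff.contMDiffAt
  have h3 : ContMDiffAt (𝓘(ℝ, E).prod 𝓘(ℝ, E)) (𝓘(ℝ, E).prod 𝓘(ℝ, E)) ∞
      e.toOpenPartialHomeomorph.symm ((extChartAt 𝓘(ℝ, E) p).symm z.1, z.2) :=
    (e.contMDiffOn_symm (n := ∞)).contMDiffAt
      (e.open_target.mem_nhds (e.mem_target.2 (hsrc _ hz)))
  refine (ContMDiffAt.comp z h3 (h1.prodMk h2)).congr_of_eventuallyEq ?_
  filter_upwards [continuous_fst.continuousAt.preimage_mem_nhds
    ((isOpen_extChartAt_target p).mem_nhds hz)] with y hy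
  exact (congrArg (TotalSpace.mk' E ((extChartAt 𝓘(ℝ, E) p).symm y.1))
    (e.symmL_apply (R := ℝ) (hsrc _ hy) y.2)).trans (e.mk_symm (hsrc _ hy) y.2)

theorem contDiffAt_comp_retraction (R : Retraction E M) {p : M} {z : E × E}
    (hz : z.1 ∈ (extChartAt 𝓘(ℝ, E) p).target) {g : M → G}
    (hg : CMDiffAt ∞ g (R.toFun (coordPoint p z))) :
    ContDiffAt ℝ ∞ (fun z => g (R.toFun (coordPoint p z))) z := by
  rw [← contMDiffAt_iff_contDiffAt]
  exact ContMDiffAt.comp z hg (ContMDiffAt.comp z R.smooth.contMDiffAt (contMDiffAt_coordPoint hz))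

/-- Rigidity of `R` concerns one fibre at a time, so the derivative is restricted to the fibre over
`u`: there the map is `g ∘ R_x ∘ L` with `L` the linear frame map, and uniqueness of derivatives
identifies the two. -/
theorem fderiv_comp_retraction (R : Retraction E M) {p : M} {u : E}
    {g : M → G} (hg : MDiffAt g ((extChartAt 𝓘(ℝ, E) p).symm u))
    (hψ : DifferentiableAt ℝ (fun z => g (R.toFun (coordPoint p z))) (u, 0)) (w : E) :
    fderiv ℝ (fun z => g (R.toFun (coordPoint p z))) (u, 0) (0, w) =
      d% g ((extChartAt 𝓘(ℝ, E) p).symm u)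
        (coordField p w ((extChartAt 𝓘(ℝ, E) p).symm u)) := by
  set x := (extChartAt 𝓘(ℝ, E) p).symm u with hx
  let L : E →L[ℝ] E := (trivializationAt E (TangentSpace 𝓘(ℝ, E)) p).symmL ℝ x
  let g' : E →L[ℝ] G := mfderiv% g x
  have h1 : HasMFDerivAt 𝓘(ℝ, E) 𝓘(ℝ, G) g (R.toFun ⟨x, L 0⟩) g' := by
    have h0 : R.toFun ⟨x, L 0⟩ = x := by
      rw [map_zero]; exact R.map_zero x
    rw [h0]; exact hg.hasMFDerivAt
  have h2 : HasMFDerivAt 𝓘(ℝ, E) 𝓘(ℝ, E)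
      (fun v : E => R.toFun (⟨x, v⟩ : TangentBundle 𝓘(ℝ, E) M)) (L 0)
      (ContinuousLinearMap.id ℝ E) := by
    rw [map_zero]; exact R.rigid x
  have h3 : HasMFDerivAt 𝓘(ℝ, E) 𝓘(ℝ, E) L (0 : E) L := L.hasFDerivAt.hasMFDerivAt
  have h4 := (HasMFDerivAt.comp (0 : E) (HasMFDerivAt.comp (L 0) h1 h2) h3).hasFDerivAt
  have h5 : HasFDerivAt (fun w : E => ((u, w) : E × E)) (ContinuousLinearMap.inr ℝ E E) 0 :=
    hasFDerivAt_prodMk_right u 0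
  have h6 := HasFDerivAt.comp (0 : E) hψ.hasFDerivAt h5
  exact congrArg (fun A : E →L[ℝ] G => A w) (h6.unique h4)

/-- In the chart at `p`, a retraction satisfies `r (u, 0) = u` and `D₂ r (u, 0) = id`. -/
theorem chart_retraction_conditions (R : Retraction E M) (p : M) :
    ContDiffAt ℝ ∞ (fun z => extChartAt 𝓘(ℝ, E) p (R.toFun (coordPoint p z)))
      (extChartAt 𝓘(ℝ, E) p p, 0) ∧
    (∀ᶠ u in 𝓝 (extChartAt 𝓘(ℝ, E) p p),
      extChartAt 𝓘(ℝ, E) p (R.toFun (coordPoint p (u, 0))) = u) ∧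
    ∀ᶠ u in 𝓝 (extChartAt 𝓘(ℝ, E) p p), ∀ w,
      fderiv ℝ (fun z => extChartAt 𝓘(ℝ, E) p (R.toFun (coordPoint p z))) (u, 0) (0, w) = w := by
  have hmem := mem_extChartAt_target (I := 𝓘(ℝ, E)) p
  have hnhds := (isOpen_extChartAt_target (I := 𝓘(ℝ, E)) p).mem_nhds hmem
  have h : ∀ u ∈ (extChartAt 𝓘(ℝ, E) p).target,
      ContDiffAt ℝ ∞ (fun z => extChartAt 𝓘(ℝ, E) p (R.toFun (coordPoint p z))) (u, 0) := by
    intro u hu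
    refine contDiffAt_comp_retraction R hu ?_
    rw [coordPoint_zero, R.map_zero]
    have hu' := (extChartAt 𝓘(ℝ, E) p).map_target hu
    rw [extChartAt_source] at hu'
    exact contMDiffAt_extChartAt' hu'
  refine ⟨h _ hmem, ?_, ?_⟩
  · filter_upwards [hnhds] with u hu
    rw [coordPoint_zero, R.map_zero, (extChartAt 𝓘(ℝ, E) p).right_inv hu]
  · filter_upwards [hnhds] with u hu w
    have hu' := (extChartAt 𝓘(ℝ, E) p).map_target hu
    rw [extChartAt_source] at hu'
    rw [fderiv_comp_retraction R (mdifferentiableAt_extChartAt hu')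
      ((h u hu).differentiableAt (by simp))]
    have e := coordVec_coordField hu' w
    rw [coordVec, TangentBundle.continuousLinearMapAt_trivializationAt hu'] at e
    exact e

end RetractionCoordinates

/-! ### Transfer of the local estimates to the manifold -/

section LocalTheory

variable {E : Type*} [NormedAddCommGroup E] [NormedSpace ℝ E] [FiniteDimensional ℝ E]
  {M : Type*} [TopologicalSpace M] [ChartedSpace E M] [IsManifold 𝓘(ℝ, E) ∞ M]
  [RiemannianBundle (fun x : M => TangentSpace 𝓘(ℝ, E) x)]
  [IsContMDiffRiemannianBundle 𝓘(ℝ, E) ∞ E (fun x : M => TangentSpace 𝓘(ℝ, E) x)]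

/-- Pairing the Newton equation with all coordinate vectors lowers its index: the Hessian becomes a
bilinear form and the gradient becomes the differential, so the inverse metric drops out. -/
theorem isNewtonDirection_iff {f : M → ℝ} (hf : ContMDiff 𝓘(ℝ, E) 𝓘(ℝ, ℝ) ∞ f) {p x : M}
    (hx : x ∈ (chartAt E p).source) {η : TangentSpace 𝓘(ℝ, E) x} :
    IsNewtonDirection f x η ↔ coordForm p (hess f) (extChartAt 𝓘(ℝ, E) p x) (coordVec p x η) =
      -fderiv ℝ (f ∘ (extChartAt 𝓘(ℝ, E) p).symm) (extChartAt 𝓘(ℝ, E) p x) := by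
  have hF : ∀ w : E, fderiv ℝ (f ∘ (extChartAt 𝓘(ℝ, E) p).symm) (extChartAt 𝓘(ℝ, E) p x) w =
      inner ℝ (grad f x) (coordField p w x) := fun w => by
    rw [inner_grad, mvfderiv_eq_fderiv_coordVec hx (hf.mdifferentiableAt (by simp)),
      coordVec_coordField hx]
  constructor
  · intro h
    ext w
    rw [coordForm_extChartAt_apply hx, coordField_coordVec hx, h, inner_neg_left, neg_apply, hF]
  · intro h
    refine ext_inner_right ℝ fun v => ?_
    have := congrArg (fun A : E →L[ℝ] ℝ => A (coordVec p x v)) h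
    rw [coordForm_extChartAt_apply hx, coordField_coordVec hx, neg_apply, hF,
      coordField_coordVec hx] at this
    rw [this, inner_neg_left]

/-- Coordinate vectors have Riemannian length at most `C` times their model norm near `p`, so the
model norm of the differential is at most `C * ‖grad f‖`. -/
theorem exists_mul_norm_fderiv_sq_le_merit {f : M → ℝ} (hf : ContMDiff 𝓘(ℝ, E) 𝓘(ℝ, ℝ) ∞ f)
    (p : M) :
    ∃ c : ℝ, 0 < c ∧ ∀ᶠ u in 𝓝 (extChartAt 𝓘(ℝ, E) p p),
      c * ‖fderiv ℝ (f ∘ (extChartAt 𝓘(ℝ, E) p).symm) u‖ ^ 2 ≤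
        merit (E := E) f ((extChartAt 𝓘(ℝ, E) p).symm u) := by
  have : IsContinuousRiemannianBundle E (fun x : M => TangentSpace 𝓘(ℝ, E) x) := by
    obtain ⟨g, hg, hg'⟩ := IsContMDiffRiemannianBundle.exists_contMDiff (IB := 𝓘(ℝ, E)) (n := ∞)
      (F := E) (E := fun x : M => TangentSpace 𝓘(ℝ, E) x)
    exact ⟨⟨g, hg.continuous, hg'⟩⟩
  obtain ⟨C, hC, h⟩ := eventually_norm_symmL_trivializationAt_lt E
    (fun x : M => TangentSpace 𝓘(ℝ, E) x) p
  refine ⟨1 / C ^ 2, by positivity, ?_⟩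
  have ht : Tendsto (extChartAt 𝓘(ℝ, E) p).symm (𝓝 (extChartAt 𝓘(ℝ, E) p p)) (𝓝 p) := by
    have := (continuousAt_extChartAt_symm (I := 𝓘(ℝ, E)) p).tendsto
    rwa [extChartAt_to_inv] at this
  filter_upwards [ht.eventually h, (isOpen_extChartAt_target p).mem_nhds
    (mem_extChartAt_target (I := 𝓘(ℝ, E)) p)] with u hu1 hu
  have hu' := (extChartAt 𝓘(ℝ, E) p).map_target hu
  rw [extChartAt_source] at hu'
  set x := (extChartAt 𝓘(ℝ, E) p).symm u
  have hb : ‖fderiv ℝ (f ∘ (extChartAt 𝓘(ℝ, E) p).symm) u‖ ≤ C * ‖grad (E := E) f x‖ := by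
    refine ContinuousLinearMap.opNorm_le_bound _ (by positivity) fun w => ?_
    have e : fderiv ℝ (f ∘ (extChartAt 𝓘(ℝ, E) p).symm) u w =
        inner ℝ (grad (E := E) f x) (coordField p w x) := by
      rw [inner_grad, mvfderiv_eq_fderiv_coordVec hu' (hf.mdifferentiableAt (by simp)),
        coordVec_coordField hu', (extChartAt 𝓘(ℝ, E) p).right_inv hu]
    rw [e]
    have hw : ‖coordField p w x‖ ≤ C * ‖w‖ :=
      (ContinuousLinearMap.le_opNorm _ w).trans (by gcongr)
    calc _ ≤ ‖grad (E := E) f x‖ * ‖coordField p w x‖ := norm_inner_le_norm _ _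
      _ ≤ ‖grad (E := E) f x‖ * (C * ‖w‖) := by gcongr
      _ = _ := by ring
  calc _ ≤ 1 / C ^ 2 * (C * ‖grad (E := E) f x‖) ^ 2 := by gcongr
    _ = ‖grad (E := E) f x‖ ^ 2 := by field_simp

/-- Near a point where the Hessian is injective, all sufficiently short steps in the Newton
direction satisfy Armijo's condition. -/
theorem exists_armijo_nhds (R : Retraction E M) {f : M → ℝ}
    (hf : ContMDiff 𝓘(ℝ, E) 𝓘(ℝ, ℝ) ∞ f) {σ : ℝ} (hσ : σ < 1) {p : M}
    (hp : Function.Injective (hess (E := E) f p)) :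
    ∃ t₀ : ℝ, 0 < t₀ ∧ ∀ᶠ x in 𝓝 p, ∀ η, IsNewtonDirection (E := E) f x η → ∀ t, 0 < t → t ≤ t₀ →
      merit (E := E) f (R.toFun ⟨x, t • η⟩) ≤ (1 - 2 * σ * t) * merit (E := E) f x := by
  have hx := mem_chart_source E p
  set φ := extChartAt 𝓘(ℝ, E) p
  have hmem := mem_extChartAt_target (I := 𝓘(ℝ, E)) p
  have hnhds := (isOpen_extChartAt_target (I := 𝓘(ℝ, E)) p).mem_nhds hmem
  set ψ : E × E → ℝ := fun z => merit (E := E) f (R.toFun (coordPoint p z))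
  have hψ : ∀ u ∈ φ.target, ContDiffAt ℝ ∞ ψ (u, 0) := fun u hu =>
    contDiffAt_comp_retraction R hu (contMDiff_merit hf).contMDiffAt
  have hψ0 : ∀ u, ψ (u, 0) = merit (E := E) f (φ.symm u) := fun u => by
    simp only [ψ, coordPoint_zero, R.map_zero]; rfl
  obtain ⟨c, hc, hlow⟩ := exists_mul_norm_fderiv_sq_le_merit hf p
  have hF := (contDiffAt_comp_extChartAt_symm hx hf.contMDiffAt).fderiv_right (m := ∞) (by simp)
  have hd : ∀ᶠ u in 𝓝 (φ p), ∀ η, coordForm p (hess f) u η = -fderiv ℝ (f ∘ φ.symm) u →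
      fderiv ℝ ψ (u, 0) (0, η) = -2 * ψ (u, 0) := by
    filter_upwards [hnhds] with u hu η hη
    have hu' := φ.map_target hu
    rw [extChartAt_source] at hu'
    rw [hψ0, fderiv_comp_retraction R ((contMDiff_merit hf).mdifferentiableAt (by simp))
      ((hψ u hu).differentiableAt (by simp))]
    refine IsNewtonDirection.mvfderiv_merit hf ?_
    rw [isNewtonDirection_iff hf hu', coordVec_coordField hu', φ.right_inv hu]
    exact hη
  obtain ⟨t₀, ht₀, h⟩ := exists_uniform_armijo (F := fderiv ℝ (f ∘ φ.symm))
    (B := coordForm p (hess f)) (a := φ p) (ψ := ψ) (c := c) (σ := σ)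
    ((hψ _ hmem).of_le (by norm_cast)) hF.continuousAt (contDiffAt_coordForm_hess hf hx).continuousAt
    (coordForm_injective hx hp) hc (by simpa only [hψ0] using hlow) hd hσ
  · refine ⟨t₀, ht₀, ?_⟩
    filter_upwards [(continuousAt_extChartAt (I := 𝓘(ℝ, E)) p).eventually h,
      (chartAt E p).open_source.mem_nhds hx] with x h1 h2 η hη t ht htt
    have h3 := h1 _ ((isNewtonDirection_iff hf h2).1 hη) t ht htt
    have e : φ.symm (φ x) = x := by simp [φ, h2]
    rw [hψ0, e] at h3
    simp only [ψ] at h3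
    rwa [← map_smul, coordPoint_coordVec h2] at h3

section Stationary

variable (R : Retraction E M) {f : M → ℝ} (hf : ContMDiff 𝓘(ℝ, E) 𝓘(ℝ, ℝ) ∞ f) {p : M}
  (hp : grad (E := E) f p = 0) (hinj : Function.Injective (hess (E := E) f p))

include hf hp in
omit [IsContMDiffRiemannianBundle 𝓘(ℝ, E) ∞ E (fun x : M => TangentSpace 𝓘(ℝ, E) x)] in
theorem fderiv_coord_eq_zero :
    fderiv ℝ (f ∘ (extChartAt 𝓘(ℝ, E) p).symm) (extChartAt 𝓘(ℝ, E) p p) = 0 := by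
  have hx := mem_chart_source E p
  ext w
  have h := mvfderiv_eq_fderiv_coordVec hx (hf.mdifferentiableAt (x := p) (by simp))
    (coordField p w p)
  rw [coordVec_coordField hx, ← inner_grad, hp, inner_zero_left] at h
  exact h.symm

include hf hp hinj

/-- Close to a nondegenerate stationary point, Newton steps stay close to it. -/
theorem eventually_newton_step_mem {N : Set M} (hN : N ∈ 𝓝 p) (T : ℝ) :
    ∀ᶠ x in 𝓝 p, ∀ η, IsNewtonDirection (E := E) f x η → ∀ t, 0 ≤ t → t ≤ T →
      R.toFun ⟨x, t • η⟩ ∈ N := by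
  have hx := mem_chart_source E p
  have hmem := mem_extChartAt_target (I := 𝓘(ℝ, E)) p
  have hF := (contDiffAt_comp_extChartAt_symm hx hf.contMDiffAt).fderiv_right (m := ∞) (by simp)
  have hcont : ContinuousAt (fun z => R.toFun (coordPoint p z)) (extChartAt 𝓘(ℝ, E) p p, 0) :=
    (R.smooth.contMDiffAt.comp _ (contMDiffAt_coordPoint hmem)).continuousAt
  have hval : R.toFun (coordPoint p (extChartAt 𝓘(ℝ, E) p p, 0)) = p := by
    rw [coordPoint_zero, R.map_zero, extChartAt_to_inv]
  have hN' : (fun z => R.toFun (coordPoint p z)) ⁻¹' N ∈ 𝓝 (extChartAt 𝓘(ℝ, E) p p, (0 : E)) :=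
    hcont.preimage_mem_nhds (by rwa [hval])
  have h := eventually_step_mem (B := coordForm p (hess f)) hN' hF.continuousAt
    (fderiv_coord_eq_zero hf hp) (contDiffAt_coordForm_hess hf hx).continuousAt
    (coordForm_injective hx hinj) T
  filter_upwards [(continuousAt_extChartAt (I := 𝓘(ℝ, E)) p).eventually h,
    (chartAt E p).open_source.mem_nhds hx] with x h1 h2 η hη t ht htT
  have h3 := h1 _ ((isNewtonDirection_iff hf h2).1 hη) t ht htT
  rwa [← map_smul, Set.mem_preimage, coordPoint_coordVec h2] at h3

/-- The full Newton step contracts quadratically near a nondegenerate stationary point. -/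
theorem exists_newton_step_quadratic :
    ∃ C : ℝ, 0 ≤ C ∧ ∀ᶠ x in 𝓝 p, ∀ η, IsNewtonDirection (E := E) f x η →
      ‖extChartAt 𝓘(ℝ, E) p (R.toFun ⟨x, (1 : ℝ) • η⟩) - extChartAt 𝓘(ℝ, E) p p‖ ≤
        C * ‖extChartAt 𝓘(ℝ, E) p x - extChartAt 𝓘(ℝ, E) p p‖ ^ 2 := by
  have hx := mem_chart_source E p
  have hF := (contDiffAt_comp_extChartAt_symm hx hf.contMDiffAt).fderiv_right (m := ∞) (by simp)
  obtain ⟨hr, hr0, hr1⟩ := chart_retraction_conditions R p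
  obtain ⟨C, hC, h⟩ := exists_step_sub_le (B := coordForm p (hess f))
    (hr.of_le (by norm_cast)) hr0 hr1 (hF.of_le (by norm_cast))
    (fderiv_coord_eq_zero hf hp) ((contDiffAt_coordForm_hess hf hx).differentiableAt (by simp))
    (coordForm_hess_eq_fderiv hf hp) (coordForm_injective hx hinj) 1 zero_le_one
  refine ⟨C, hC, ?_⟩
  filter_upwards [(continuousAt_extChartAt (I := 𝓘(ℝ, E)) p).eventually h,
    (chartAt E p).open_source.mem_nhds hx] with x h1 h2 η hη
  have h3 := h1 _ ((isNewtonDirection_iff hf h2).1 hη)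
  rwa [← map_smul, coordPoint_coordVec h2, sub_self, zero_smul, sub_zero] at h3

/-- Near a nondegenerate stationary point, a step of length `t` in the Newton direction multiplies
the merit function by `(1 - t) ^ 2` up to a small relative error. -/
theorem eventually_merit_newton_step (t : ℝ) (ht : 0 ≤ t) {ε : ℝ} (hε : 0 < ε) :
    ∀ᶠ x in 𝓝 p, ∀ η, IsNewtonDirection (E := E) f x η →
      |merit (E := E) f (R.toFun ⟨x, t • η⟩) - (1 - t) ^ 2 * merit (E := E) f x| ≤
        ε * merit (E := E) f x := by
  have hx := mem_chart_source E p
  have hF := (contDiffAt_comp_extChartAt_symm hx hf.contMDiffAt).fderiv_right (m := ∞) (by simp)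
  obtain ⟨hr, hr0, hr1⟩ := chart_retraction_conditions R p
  obtain ⟨c, hc, hlow⟩ := exists_mul_norm_fderiv_sq_le_merit hf p
  have hh := contDiffAt_comp_extChartAt_symm hx (contMDiff_merit (E := E) hf).contMDiffAt
  have hh0 : (merit (E := E) f ∘ (extChartAt 𝓘(ℝ, E) p).symm) (extChartAt 𝓘(ℝ, E) p p) = 0 := by
    rw [Function.comp_apply, extChartAt_to_inv, merit, hp, norm_zero]
    norm_num
  have h := eventually_merit_step (B := coordForm p (hess f))
    (hr.of_le (by norm_cast)) hr0 hr1 (hF.of_le (by norm_cast))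
    (fderiv_coord_eq_zero hf hp) ((contDiffAt_coordForm_hess hf hx).differentiableAt (by simp))
    (coordForm_hess_eq_fderiv hf hp) (coordForm_injective hx hinj)
    (hh.of_le (by norm_cast)) hh0 hc hlow t ht hε
  filter_upwards [(continuousAt_extChartAt (I := 𝓘(ℝ, E)) p).eventually h,
    (chartAt E p).open_source.mem_nhds hx, eventually_newton_step_mem R hf hp hinj
      ((chartAt E p).open_source.mem_nhds hx) t] with x h1 h2 h4 η hη
  have h3 := h1 _ ((isNewtonDirection_iff hf h2).1 hη)
  -- The coordinate estimate evaluates the merit function through the inverse chart, so the new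
  -- point must lie in the chart domain; `h4` ensures this.
  have h5 : (extChartAt 𝓘(ℝ, E) p).symm (extChartAt 𝓘(ℝ, E) p (R.toFun ⟨x, t • η⟩)) =
      R.toFun ⟨x, t • η⟩ := by
    simp [show _ ∈ (chartAt E p).source from h4 η hη t ht le_rfl]
  have h6 : (extChartAt 𝓘(ℝ, E) p).symm (extChartAt 𝓘(ℝ, E) p x) = x := by simp [h2]
  rwa [← map_smul, coordPoint_coordVec h2, Function.comp_apply, Function.comp_apply, h5, h6] at h3

end Stationary
end LocalTheory

/-! ### Well-definedness, convergence and rate of the line search -/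

section Global

variable {E : Type*} [NormedAddCommGroup E] [NormedSpace ℝ E] [FiniteDimensional ℝ E]
  {M : Type*} [TopologicalSpace M] [ChartedSpace E M] [IsManifold 𝓘(ℝ, E) ∞ M]
  [RiemannianBundle (fun x : M => TangentSpace 𝓘(ℝ, E) x)]
  [IsContMDiffRiemannianBundle 𝓘(ℝ, E) ∞ E (fun x : M => TangentSpace 𝓘(ℝ, E) x)]
  {R : Retraction E M} {f : M → ℝ} {α β σ : ℝ}

omit [IsManifold 𝓘(ℝ, E) ∞ M]
  [IsContMDiffRiemannianBundle 𝓘(ℝ, E) ∞ E (fun x : M => TangentSpace 𝓘(ℝ, E) x)] in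
theorem merit_nonneg (f : M → ℝ) (x : M) :
    0 ≤ merit (E := E) f x := sq_nonneg _

omit [IsManifold 𝓘(ℝ, E) ∞ M]
  [IsContMDiffRiemannianBundle 𝓘(ℝ, E) ∞ E (fun x : M => TangentSpace 𝓘(ℝ, E) x)] in
theorem merit_pos {f : M → ℝ} {x : M}
    (h : grad (E := E) f x ≠ 0) : 0 < merit (E := E) f x :=
  pow_pos (norm_pos_iff.2 h) 2

theorem existsUnique_isNewtonDirection {x : M} (hx : Function.Injective (hess (E := E) f x)) :
    ∃! η, IsNewtonDirection (E := E) f x η := by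
  have hs : Function.Surjective (hess (E := E) f x) :=
    (LinearMap.injective_iff_surjective (f := (hess (E := E) f x).toLinearMap)).1 hx
  obtain ⟨η, hη⟩ := hs (-grad (E := E) f x)
  exact ⟨η, hη, fun η' hη' => hx (hη'.trans hη.symm)⟩

theorem IsNewtonDirection.armijoCondition_iff (hf : ContMDiff 𝓘(ℝ, E) 𝓘(ℝ, ℝ) ∞ f) {x : M}
    {η : TangentSpace 𝓘(ℝ, E) x} (hη : IsNewtonDirection f x η) (t : ℝ) :
    ArmijoCondition R f σ x η t ↔
      merit (E := E) f (R.toFun ⟨x, t • η⟩) ≤ (1 - 2 * σ * t) * merit (E := E) f x := by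
  rw [ArmijoCondition, hη.mvfderiv_merit hf]
  have e : merit (E := E) f x + σ * t * (-2 * merit (E := E) f x) =
    (1 - 2 * σ * t) * merit (E := E) f x := by ring
  rw [e]

theorem exists_armijoCondition (hf : ContMDiff 𝓘(ℝ, E) 𝓘(ℝ, ℝ) ∞ f) (hα : 0 < α)
    (hβ : β ∈ Set.Ioo (0 : ℝ) 1) (hσ : σ < 1) {x : M}
    (hx : Function.Injective (hess (E := E) f x)) {η : TangentSpace 𝓘(ℝ, E) x}
    (hη : IsNewtonDirection f x η) : ∃ l : ℕ, ArmijoCondition R f σ x η (α * β ^ l) := by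
  obtain ⟨t₀, ht₀, h⟩ := exists_armijo_nhds R hf hσ hx
  obtain ⟨l, hl⟩ := exists_pow_lt_of_lt_one (div_pos ht₀ hα) hβ.2
  refine ⟨l, (hη.armijoCondition_iff hf _).2 (h.self_of_nhds η hη _ ?_ ?_)⟩
  · exact mul_pos hα (pow_pos hβ.1 l)
  · rw [lt_div_iff₀ hα] at hl
    linarith

theorem existsUnique_isNewtonArmijoStep (hf : ContMDiff 𝓘(ℝ, E) 𝓘(ℝ, ℝ) ∞ f) (hα : 0 < α)
    (hβ : β ∈ Set.Ioo (0 : ℝ) 1) (hσ : σ < 1) {x : M}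
    (hx : Function.Injective (hess (E := E) f x)) : ∃! y, IsNewtonArmijoStep R f α β σ x y := by
  obtain ⟨η, hη, huniq⟩ := existsUnique_isNewtonDirection hx
  have hne : {j : ℕ | ArmijoCondition R f σ x η (α * β ^ j)}.Nonempty :=
    exists_armijoCondition hf hα hβ hσ hx hη
  refine ⟨_, ⟨η, hη, _, isLeast_csInf hne, rfl⟩, ?_⟩
  rintro y ⟨η', hη', l, hl, rfl⟩
  obtain rfl := huniq η' hη'
  rw [hl.unique (isLeast_csInf hne)]

theorem IsNewtonArmijoStep.eq_of_grad_eq_zero {x y : M}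
    (hx : Function.Injective (hess (E := E) f x)) (h0 : grad (E := E) f x = 0)
    (h : IsNewtonArmijoStep R f α β σ x y) : y = x := by
  obtain ⟨η, hη, l, -, rfl⟩ := h
  have : η = 0 := by
    apply hx
    rw [map_zero, hη, h0, neg_zero]
  rw [this, smul_zero, R.map_zero]

/-- The local thresholds of `exists_armijo_nhds` are combined by compactness, taking the minimum
over a finite cover. -/
theorem exists_armijo_of_isCompact (R : Retraction E M) (hf : ContMDiff 𝓘(ℝ, E) 𝓘(ℝ, ℝ) ∞ f)
    (hσ : σ < 1) {K : Set M} (hK : IsCompact K)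
    (hinj : ∀ x ∈ K, Function.Injective (hess (E := E) f x)) :
    ∃ t₀ : ℝ, 0 < t₀ ∧ ∀ x ∈ K, ∀ η, IsNewtonDirection (E := E) f x η → ∀ t, 0 < t → t ≤ t₀ →
      merit (E := E) f (R.toFun ⟨x, t • η⟩) ≤ (1 - 2 * σ * t) * merit (E := E) f x := by
  refine hK.induction_on (p := fun s => ∃ t₀ : ℝ, 0 < t₀ ∧ ∀ x ∈ s, ∀ η,
    IsNewtonDirection (E := E) f x η → ∀ t, 0 < t → t ≤ t₀ →
      merit (E := E) f (R.toFun ⟨x, t • η⟩) ≤ (1 - 2 * σ * t) * merit (E := E) f x)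
    ⟨1, one_pos, by simp⟩ ?_ ?_ ?_
  · rintro s s' hss ⟨t₀, ht₀, h⟩
    exact ⟨t₀, ht₀, fun x hx => h x (hss hx)⟩
  · rintro s s' ⟨t₀, ht₀, h⟩ ⟨t₁, ht₁, h'⟩
    refine ⟨min t₀ t₁, lt_min ht₀ ht₁, fun x hx η hη t ht htt => ?_⟩
    rcases hx with hx | hx
    · exact h x hx η hη t ht (htt.trans (min_le_left _ _))
    · exact h' x hx η hη t ht (htt.trans (min_le_right _ _))
  · intro x hx
    obtain ⟨t₀, ht₀, h⟩ := exists_armijo_nhds R hf hσ (hinj x hx)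
    exact ⟨_, mem_nhdsWithin_of_mem_nhds h, t₀, ht₀, fun y hy => hy⟩

/-- On a compact set one iteration decreases the merit function by a uniform factor. -/
theorem exists_merit_contraction (R : Retraction E M) (hf : ContMDiff 𝓘(ℝ, E) 𝓘(ℝ, ℝ) ∞ f)
    (hα : 0 < α) (hβ : β ∈ Set.Ioo (0 : ℝ) 1) (hσ : σ ∈ Set.Ioo (0 : ℝ) 1) {K : Set M}
    (hK : IsCompact K) (hinj : ∀ x ∈ K, Function.Injective (hess (E := E) f x)) :
    ∃ q : ℝ, 0 ≤ q ∧ q < 1 ∧ ∀ x ∈ K, ∀ y, IsNewtonArmijoStep R f α β σ x y →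
      merit (E := E) f y ≤ q * merit (E := E) f x := by
  obtain ⟨t₀, ht₀, h⟩ := exists_armijo_of_isCompact R hf hσ.2 hK hinj
  -- A lower bound for accepted steps: either the first trial `α` is taken, or the trial before was
  -- rejected and so exceeded `t₀`, whence the accepted one exceeds `β * t₀`.
  set τ : ℝ := min α (β * t₀)
  have hτ : 0 < τ := lt_min hα (mul_pos hβ.1 ht₀)
  refine ⟨max 0 (1 - 2 * σ * τ), le_max_left _ _, max_lt one_pos ?_, ?_⟩
  · have := mul_pos hσ.1 hτ
    linarith
  rintro x hx y ⟨η, hη, l, hl, rfl⟩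
  have h1 : τ ≤ α * β ^ l := by
    rcases l with _ | l
    · rw [pow_zero, mul_one]
      exact min_le_left α (β * t₀)
    · have h2 : t₀ < α * β ^ l := by
        by_contra! hle
        have := hl.2 ((hη.armijoCondition_iff (R := R) hf (σ := σ) _).2
          (h x hx η hη _ (mul_pos hα (pow_pos hβ.1 l)) hle))
        omega
      calc τ ≤ β * t₀ := min_le_right _ _
        _ ≤ β * (α * β ^ l) := mul_le_mul_of_nonneg_left h2.le hβ.1.le
        _ = _ := by ring
  refine ((hη.armijoCondition_iff hf _).1 hl.1).trans
    (mul_le_mul_of_nonneg_right (le_max_of_le_right ?_) (merit_nonneg f x))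
  have := mul_le_mul_of_nonneg_left h1 hσ.1.le
  linarith

/-- A run that stays in a compact set without further stationary points converges. -/
theorem IsNewtonArmijoRun.tendsto (hf : ContMDiff 𝓘(ℝ, E) 𝓘(ℝ, ℝ) ∞ f)
    (hα : 0 < α) (hβ : β ∈ Set.Ioo (0 : ℝ) 1) (hσ : σ ∈ Set.Ioo (0 : ℝ) 1) {K : Set M} {p : M}
    (hK : IsCompact K) (hinj : ∀ x ∈ K, Function.Injective (hess (E := E) f x))
    (hgrad : ∀ x ∈ K, x ≠ p → grad (E := E) f x ≠ 0) {x : ℕ → M}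
    (hx : IsNewtonArmijoRun R f α β σ x) (hxK : ∀ k, x k ∈ K) : Tendsto x atTop (𝓝 p) := by
  obtain ⟨q, hq0, hq1, hq⟩ := exists_merit_contraction R hf hα hβ hσ hK hinj
  have hle : ∀ k, merit (E := E) f (x k) ≤ q ^ k * merit (E := E) f (x 0) := by
    intro k
    induction k with
    | zero => simp
    | succ k ih =>
      calc _ ≤ q * merit (E := E) f (x k) := hq _ (hxK k) _ (hx k)
        _ ≤ q * (q ^ k * merit (E := E) f (x 0)) := by gcongr
        _ = _ := by ring
  have hlim : Tendsto (fun k => merit (E := E) f (x k)) atTop (𝓝 0) := by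
    refine squeeze_zero (fun k => merit_nonneg f _) hle ?_
    simpa using (tendsto_pow_atTop_nhds_zero_of_lt_one hq0 hq1).mul_const (merit (E := E) f (x 0))
  refine tendsto_def.2 fun N hN => ?_
  obtain ⟨N', hN', hopen, hpN⟩ := mem_nhds_iff.1 hN
  -- Off a neighbourhood of `p` the merit function has a positive lower bound on `K`, so merit
  -- values tending to zero force the iterates into the neighbourhood.
  obtain ⟨m, hm, hmin⟩ := (hK.diff hopen).exists_forall_le'
    (contMDiff_merit (E := E) hf).continuous.continuousOn (a := 0)
    (fun y hy => merit_pos (hgrad y hy.1 fun h => hy.2 (h ▸ hpN)))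
  filter_upwards [hlim.eventually (gt_mem_nhds hm)] with k hk
  by_contra hxk
  exact absurd (hmin (x k) ⟨hxK k, fun h => hxk (hN' h)⟩) (not_le.2 hk)

theorem exists_isNewtonArmijoRun {U : Set M} {x₀ : M} (hx₀ : x₀ ∈ U)
    (hU : ∀ x ∈ U, ∃! y, IsNewtonArmijoStep R f α β σ x y)
    (hUU : ∀ x ∈ U, ∀ y, IsNewtonArmijoStep R f α β σ x y → y ∈ U) :
    (∃! x : ℕ → M, x 0 = x₀ ∧ IsNewtonArmijoRun R f α β σ x) ∧
      ∀ x : ℕ → M, x 0 = x₀ → IsNewtonArmijoRun R f α β σ x → ∀ k, x k ∈ U := by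
  have hmem : ∀ x : ℕ → M, x 0 = x₀ → IsNewtonArmijoRun R f α β σ x → ∀ k, x k ∈ U := by
    intro x hx hrun k
    induction k with
    | zero => rwa [hx]
    | succ k ih => exact hUU _ ih _ (hrun k)
  refine ⟨?_, hmem⟩
  choose! s hs huniq using hU
  have hs' : ∀ k, s^[k] x₀ ∈ U := by
    intro k
    induction k with
    | zero => exact hx₀
    | succ k ih =>
      rw [Function.iterate_succ_apply']
      exact hUU _ ih _ (hs _ ih)
  refine ⟨fun k => s^[k] x₀, ⟨rfl, fun k => ?_⟩, ?_⟩
  · change IsNewtonArmijoStep R f α β σ (s^[k] x₀) (s^[k + 1] x₀)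
    rw [Function.iterate_succ_apply']
    exact hs _ (hs' k)
  · rintro x ⟨hx, hrun⟩
    funext k
    induction k with
    | zero => exact hx
    | succ k ih =>
      rw [huniq _ (hmem x hx hrun k) _ (hrun k), ih, Function.iterate_succ_apply']

/-- A nondegenerate stationary point has arbitrarily small neighbourhoods that are invariant under
the iteration. -/
theorem exists_invariant_nhds (R : Retraction E M) (hf : ContMDiff 𝓘(ℝ, E) 𝓘(ℝ, ℝ) ∞ f)
    (hα : 0 < α) (hβ : β ∈ Set.Ioo (0 : ℝ) 1) (hσ : σ ∈ Set.Ioo (0 : ℝ) 1) {K : Set M} {p : M}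
    (hK : IsCompact K) (hKp : K ∈ 𝓝 p) (hp : grad (E := E) f p = 0)
    (hinj : ∀ x ∈ K, Function.Injective (hess (E := E) f x))
    (hgrad : ∀ x ∈ K, x ≠ p → grad (E := E) f x ≠ 0) :
    ∃ U ∈ 𝓝 p, U ⊆ K ∧ ∀ x ∈ U, ∀ y, IsNewtonArmijoStep R f α β σ x y → y ∈ U := by
  obtain ⟨q, hq0, hq1, hq⟩ := exists_merit_contraction R hf hα hβ hσ hK hinj
  obtain ⟨W, hW, hopen, hpW⟩ := mem_nhds_iff.1
    (eventually_newton_step_mem R hf hp (hinj p (mem_of_mem_nhds hKp)) hKp α)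
  have hcont := (contMDiff_merit (E := E) hf).continuous
  obtain ⟨m, hm, hmin⟩ := (hK.diff hopen).exists_forall_le' hcont.continuousOn (a := 0)
    (fun y hy => merit_pos (hgrad y hy.1 fun h => hy.2 (h ▸ hpW)))
  have hp0 : merit (E := E) f p = 0 := by rw [merit, hp, norm_zero]; norm_num
  -- From `W` every trial step lands in `K`, and `m` bounds the merit function below on `K \ W`. An
  -- iterate stays in `K` with merit still below `m`, so it cannot leave `W`.
  refine ⟨(K ∩ W) ∩ {x | merit (E := E) f x < m}, inter_mem (inter_mem hKp (hopen.mem_nhds hpW))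
    (hcont.continuousAt.eventually_lt continuousAt_const (hp0.trans_lt hm)), fun x hx => hx.1.1, ?_⟩
  rintro x ⟨⟨hxK, hxW⟩, hxm⟩ y hy
  have hym : merit (E := E) f y < m := by
    refine ((hq x hxK y hy).trans ?_).trans_lt hxm
    exact mul_le_of_le_one_left (merit_nonneg f x) hq1.le
  obtain ⟨η, hη, l, -, rfl⟩ := hy
  have hyK := hW hxW η hη (α * β ^ l) (mul_pos hα (pow_pos hβ.1 l)).le
    (mul_le_of_le_one_right hα.le (pow_le_one₀ hβ.1.le hβ.2.le))
  exact ⟨⟨hyK, by_contra fun h => absurd (hmin _ ⟨hyK, h⟩) (not_le.2 hym)⟩, hym⟩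

/-- Near a nondegenerate stationary point the line search accepts the full Newton step. -/
theorem eventually_step_eq_newton_step (R : Retraction E M) (hf : ContMDiff 𝓘(ℝ, E) 𝓘(ℝ, ℝ) ∞ f)
    (hα : 0 < α) (hβ : β ∈ Set.Ioo (0 : ℝ) 1) {p : M} (hp : grad (E := E) f p = 0)
    (hinj : Function.Injective (hess (E := E) f p)) (hunit : AdmitsUnitStep α β σ) :
    ∀ᶠ x in 𝓝 p, grad (E := E) f x ≠ 0 → ∀ y, IsNewtonArmijoStep R f α β σ x y →
      ∃ η : TangentSpace 𝓘(ℝ, E) x, IsNewtonDirection f x η ∧ y = R.toFun ⟨x, (1 : ℝ) • η⟩ := by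
  obtain ⟨hσ, m, hm, hlong⟩ := hunit
  have hacc := eventually_merit_newton_step R hf hp hinj 1 zero_le_one
    (show 0 < 1 - 2 * σ by linarith)
  -- With `t = α * β ^ j`, the gap is `(1 - t) ^ 2 - (1 - 2 * σ * t) = t * (t - 2 * (1 - σ)) > 0`; a
  -- relative error of half this gap still violates Armijo's condition. Only finitely many `j`
  -- precede `m`.
  have hrej : ∀ᶠ x in 𝓝 p, ∀ j ∈ Set.Iio m, ∀ η, IsNewtonDirection (E := E) f x η →
      |merit (E := E) f (R.toFun ⟨x, (α * β ^ j) • η⟩) -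
        (1 - α * β ^ j) ^ 2 * merit (E := E) f x| ≤
          α * β ^ j * (α * β ^ j - 2 * (1 - σ)) / 2 * merit (E := E) f x := by
    refine (Filter.eventually_all_finite (Set.finite_Iio m)).2 fun j hj => ?_
    have hj' : 0 < α * β ^ j := mul_pos hα (pow_pos hβ.1 j)
    refine eventually_merit_newton_step R hf hp hinj _ hj'.le ?_
    exact half_pos (mul_pos hj' (sub_pos.2 (hlong j hj)))
  filter_upwards [hacc, hrej] with x h1 h2 hx y hy
  obtain ⟨η, hη, l, hl, rfl⟩ := hy
  -- Rejection needs strict positivity: at a zero of the gradient a zero Newton direction makes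
  -- every trial step acceptable.
  have hpos := merit_pos hx
  refine ⟨η, hη, ?_⟩
  have hlm : l ≤ m := by
    refine hl.2 ((hη.armijoCondition_iff hf _).2 ?_)
    rw [hm]
    have h3 := (abs_le.1 (h1 η hη)).2
    linarith
  have hml : m ≤ l := by
    by_contra! hlt
    have h3 := (hη.armijoCondition_iff hf _).1 hl.1
    have h4 := (abs_le.1 (h2 l hlt η hη)).1
    have hl0 : 0 < α * β ^ l := mul_pos hα (pow_pos hβ.1 l)
    have h5 := mul_pos (mul_pos hl0 (sub_pos.2 (hlong l hlt))) hpos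
    nlinarith
  rw [le_antisymm hlm hml, hm]

theorem IsNewtonArmijoRun.convergesQuadratically (hf : ContMDiff 𝓘(ℝ, E) 𝓘(ℝ, ℝ) ∞ f)
    (hα : 0 < α) (hβ : β ∈ Set.Ioo (0 : ℝ) 1) {V : Set M} {p : M} (hV : V ∈ 𝓝 p)
    (hp : grad (E := E) f p = 0) (hinj : ∀ x ∈ V, Function.Injective (hess (E := E) f x))
    (hgrad : ∀ x ∈ V, x ≠ p → grad (E := E) f x ≠ 0) (hunit : AdmitsUnitStep α β σ) {x : ℕ → M}
    (hx : IsNewtonArmijoRun R f α β σ x) (hlim : Tendsto x atTop (𝓝 p)) :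
    ConvergesQuadratically E x p := by
  have hpinj := hinj p (mem_of_mem_nhds hV)
  obtain ⟨C, hC, hquad⟩ := exists_newton_step_quadratic R hf hp hpinj
  refine ⟨hlim, C, ?_⟩
  filter_upwards [hlim.eventually hquad, hlim.eventually hV,
    hlim.eventually (eventually_step_eq_newton_step R hf hα hβ hp hpinj hunit)] with k h1 hkV h2
  -- An iterate that hits `p` exactly stays there, and the bound is trivial; otherwise the full
  -- Newton step is taken.
  by_cases h0 : grad (E := E) f (x k) = 0
  · have e1 : x k = p := by_contra fun h => hgrad _ hkV h h0
    have e2 : x (k + 1) = p := ((hx k).eq_of_grad_eq_zero (hinj _ hkV) h0).trans e1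
    rw [e2, sub_self, norm_zero]
    positivity
  · obtain ⟨η, hη, hy⟩ := h2 h0 _ (hx k)
    rw [hy]
    exact h1 η hη

end Global
end RiemNewton
end

/-! ### The main theorem -/

theorem mainTheorem1 {E : Type*} [NormedAddCommGroup E] [NormedSpace ℝ E] [FiniteDimensional ℝ E]
    {M : Type*} [TopologicalSpace M] [T2Space M] [ChartedSpace E M] [IsManifold 𝓘(ℝ, E) ∞ M]
    [RiemannianBundle (fun x : M => TangentSpace 𝓘(ℝ, E) x)]
    [IsContMDiffRiemannianBundle 𝓘(ℝ, E) ∞ E (fun x : M => TangentSpace 𝓘(ℝ, E) x)]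
    (R : RiemNewton.Retraction E M)
    (f : M → ℝ) (hf : ContMDiff 𝓘(ℝ, E) 𝓘(ℝ, ℝ) ∞ f)
    (α β σ : ℝ) (hα : 0 < α) (hβ : β ∈ Set.Ioo (0 : ℝ) 1) (hσ : σ ∈ Set.Ioo (0 : ℝ) 1)
    (xstar : M) (hstar : RiemNewton.grad (E := E) f xstar = 0)
    (V : Set M) (hV : V ∈ 𝓝 xstar)
    (hgrad : ∀ x ∈ V, x ≠ xstar → RiemNewton.grad (E := E) f x ≠ 0)
    (hhess : ∀ x ∈ V, Function.Injective (RiemNewton.hess (E := E) f x)) :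
    -- an iteration can be carried out at every point of `V`
    (∀ x ∈ V, (∃! η, RiemNewton.IsNewtonDirection (E := E) f x η) ∧
      ∀ η, RiemNewton.IsNewtonDirection (E := E) f x η →
        ∃ l : ℕ, RiemNewton.ArmijoCondition R f σ x η (α * β ^ l)) ∧
    -- local convergence
    (∃ U ∈ 𝓝 xstar, U ⊆ V ∧ ∀ x₀ ∈ U,
      (∃! x : ℕ → M, x 0 = x₀ ∧ RiemNewton.IsNewtonArmijoRun R f α β σ x) ∧
      ∀ x : ℕ → M, x 0 = x₀ → RiemNewton.IsNewtonArmijoRun R f α β σ x →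
        (∀ k, x k ∈ V) ∧ Tendsto x atTop (𝓝 xstar) ∧
        (RiemNewton.AdmitsUnitStep α β σ → RiemNewton.ConvergesQuadratically E x xstar)) ∧
    -- convergence from an arbitrary first iterate, as long as the iterates stay in a compact subset
    (∀ K ⊆ V, IsCompact K → ∀ x : ℕ → M, RiemNewton.IsNewtonArmijoRun R f α β σ x →
      (∀ k, x k ∈ K) → Tendsto x atTop (𝓝 xstar) ∧
        (RiemNewton.AdmitsUnitStep α β σ → RiemNewton.ConvergesQuadratically E x xstar)) := by
  refine ⟨fun x hx => ⟨RiemNewton.existsUnique_isNewtonDirection (hhess x hx), fun η hη =>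
    RiemNewton.exists_armijoCondition hf hα hβ hσ.2 (hhess x hx) hη⟩, ?_, ?_⟩
  · have : LocallyCompactSpace M := ChartedSpace.locallyCompactSpace E M
    -- A compact neighbourhood inside `V` makes the contraction uniform; the invariant `U` inside it
    -- then keeps runs in `K`, which reduces local convergence to the compact case.
    obtain ⟨K, hK, hKV, hKc⟩ := local_compact_nhds hV
    have hinj : ∀ x ∈ K, Function.Injective (RiemNewton.hess (E := E) f x) :=
      fun x hx => hhess x (hKV hx)
    have hne : ∀ x ∈ K, x ≠ xstar → RiemNewton.grad (E := E) f x ≠ 0 :=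
      fun x hx => hgrad x (hKV hx)
    obtain ⟨U, hU, hUK, hinv⟩ := RiemNewton.exists_invariant_nhds (α := α) (β := β) R hf hα hβ hσ
      hKc hK hstar hinj hne
    refine ⟨U, hU, hUK.trans hKV, fun x₀ hx₀ => ?_⟩
    obtain ⟨hrun, hmem⟩ := RiemNewton.exists_isNewtonArmijoRun hx₀ (fun x hx =>
      RiemNewton.existsUnique_isNewtonArmijoStep hf hα hβ hσ.2 (hinj x (hUK hx))) hinv
    refine ⟨hrun, fun x hx0 hx => ?_⟩
    have hxK : ∀ k, x k ∈ K := fun k => hUK (hmem x hx0 hx k)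
    have hlim := hx.tendsto hf hα hβ hσ hKc hinj hne hxK
    exact ⟨fun k => hKV (hxK k), hlim, fun hunit =>
      hx.convergesQuadratically hf hα hβ hV hstar hhess hgrad hunit hlim⟩
  · intro K hKV hKc x hx hxK
    have hlim := hx.tendsto hf hα hβ hσ hKc (fun y hy => hhess y (hKV hy))
      (fun y hy => hgrad y (hKV hy)) hxK
    exact ⟨hlim, fun hunit =>
      hx.convergesQuadratically hf hα hβ hV hstar hhess hgrad hunit hlim⟩
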